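/- **Setting.** Let $N\ge 1$, and let $\mathcal S=\{(x_i,y_i)\}_{i=1}^N$ with $x_i\in\mathbb R^n$, $y_i\in\mathbb R$, $\|x_i\|=1$, $|y_i|\le B$, and $x_i\ne\pm x_j$ for $i\ne j$. Expectation over the input $x$ is with respect to the empirical distribution of $x_1,\dots,x_N$; assume $\mathbb E[x]=0$ and that $V=\mathbb E[xx^\top]$ is positive definite, with smallest eigenvalue $\sigma_V>0$. Write $\mathrm{Gr}(1,n)=\{d\in\mathbb R^n:\|d\|=1\}$. For $\theta=(\theta_1,\dots,\theta_m)\in \mathrm{Gr}(1,n)^m$ and $a\in\{-1,1\}^m$ the two-layer ReLU network with batch normalization has output $$u(\theta)_i=\frac1{\sqrt m}\sum_{j=1}^m a_j\max\Big\{\frac{\theta_j^\top x_i}{\sqrt{\theta_j^\top V\theta_j}},0\Big\},\qquad i=1,\dots,N.$$ With $\varphi_i(w)=\frac{x_i}{\sqrt{w^\top Vw}}-\frac{Vww^\top x_i}{(w^\top Vw)^{3/2}}$, its (generalized) Riemannian Jacobian $J(\theta)\in\mathbb R^{N\times mn}$ has as its $(i,j)$ block the row $\frac{a_j}{\sqrt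 m}\mathbf 1[x_i^\top\theta_j\ge0]\,\varphi_i(\theta_j)^\top$. Let $M=\max_i\max_{w\in \mathrm{Gr}(1,n)}\|\varphi_i(w)\|^2$, and let $L>0$ be such that every $\varphi_i$ is $L$-Lipschitz on $\mathrm{Gr}(1,n)$. All vector norms are Euclidean and the norm of a matrix is the Frobenius norm. Let $p(\cdot\mid z)$, $z\in\mathbb R$, be probability densities on $\mathbb R$ with respect to a fixed reference measure, with $p(y_i\mid z)>0$ for all $i$ and $z$, and let $\mathcal L(z,y)=-\log p(y\mid z)$. Assume that there are constants $\mu,\kappa_L,\kappa_H>0$ such that for every $i$ the function $\mathcal L(\cdot,y_i)$ is $C^2$, $\mu\le\partial_z^2\mathcal L(z,y_i)\le\kappa_L$ for all $z$, $\partial_z^2\mathcal L(\cdot,y_i)$ is $\kappa_H$-Lipschitz, and $\partial_z\mathcal L(y_i,y_i)=0$. Assume also that the Fisher information $F_{\mathcal L}(z)=\mathbb E_{y\sim p(\cdot\mid z)}[(\partial_z\log p(y\mid z))^2]$ equals $\partial_z^2\mathcal L(z,y_i)$ at every $z=u(\theta)_i$ ($\theta\in \mathrm{Gr}(1,n)^m$,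 $a\in\{-1,1\}^m$). Draw $\theta^0_1,\dots,\theta^0_m$ uniformly from $\mathrm{Gr}(1,n)$ and $a_1,\dots,a_m$ uniformly from $\{-1,+1\}$, all independently. Put $u^0=u(\theta^0)$ and $\sigma_0=\sqrt{\lambda_{\min}(J(\theta^0)J(\theta^0)^\top)}$ (a random variable), and $c=\min\{\frac12,\frac{\mu}{6\kappa_L}\}$. *Riemannian Jacobian stability* means: $\sigma_0>0$, and $\|J(\theta)-J(\theta^0)\|\le c\,\sigma_0$ for all $\theta\in \mathrm{Gr}(1,n)^m$ with $\|\theta-\theta^0\|\le4\kappa_L(\mu\sigma_0)^{-1}\|u^0-y\|$. The *RNGD iterates* with step size $\eta$ are $\theta^{k+1}=\exp_{\theta^k}(-\eta d^k)$ and $u^k=u(\theta^k)$. Here $\exp$ is the exponential map of the product of spheres $\mathrm{Gr}(1,n)^m$, $d^k=F(\theta^k)^\dagger J(\theta^k)^\top\nabla \mathcal L(u^k,y)$ with $\nabla \mathcal L(u,y)=(\partial_z\mathcal L(u_i,y_i))_i$, $H(\theta)=\mathrm{diag}(F_{\mathcal L}(u(\theta)_i))_{i=1}^N$, and $F^\dagger=J^\top(JJ^\top)^{-1}H^{-1}(JJ^\top)^{-1}J$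 is the pseudo-inverse of $F=J^\top HJ$ (when $JJ^\top$ is invertible). **Theorem.** There are an absolute constant $\kappa_1>0$ and, for every $B$, a constant $C>0$ depending only on $B$, such that in the above setting the following hold for every $\epsilon>0$. 1. With probability at least $1-\epsilon$: if $\sigma_0>0$ and $$m\ \ge\ C\cdot\frac{128(L+2M)^3\pi nN^6\kappa_L^2}{\mu^2\sigma_0^8\sigma_V\epsilon^3c^6},$$ then the Riemannian Jacobian stability condition holds. 2. With probability at least $1-\epsilon$: if $\sigma_0>0$, $$m\ \ge\ \frac{16(L+2M)^3\pi nN^5\kappa_L^2}{9\sigma_0^8\kappa_H^2\epsilon^2c^6},\qquad \|u^0-y\|\le\frac{\mu}{3\kappa_H},$$ and $0<\eta\le\min\Big\{1,\Big(\frac1{6\|u^0-y\|}-\frac{\kappa_H}{2\mu}\Big)\frac{3\mu^2\sigma_0}{8\kappa_R\kappa_L^2}\Big\}$, where $\kappa_R=\kappa_1\Big(\frac14+\frac{\|J(\theta^0)\|}{2\sigma_0}\Big)$ (the second bound on $\eta$ is dropped if $u^0=y$), then for all $k\ge0$ $$\|u^{k+1}-y\|\le\Big(1-\frac{\eta}{2}\Big)\|u^k-y\|.$$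 In both parts, "with probability at least $1-\epsilon$" means that there is a measurable event of probability at least $1-\epsilon$ on which the stated implication holds; in part 2 the event depends neither on $\eta$ nor on $k$. -/

import Mathlib

open MeasureTheory
open scoped Matrix

namespace RNGD

noncomputable section

/-- Input space `ℝⁿ` with its Euclidean norm. -/
abbrev Vec (n : ℕ) := EuclideanSpace ℝ (Fin n)

/-- `Gr(1,n)`, represented by the unit vectors of `ℝⁿ`. -/
abbrev Gr1 (n : ℕ) := Metric.sphere (0 : Vec n) 1

/-! ### Random initialization -/

/-- The uniform probability distribution on `Gr(1,n)`: normalized surface measure. -/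
def uniformGr1 (n : ℕ) : Measure (Gr1 n) :=
  ((volume : Measure (Vec n)).toSphere Set.univ)⁻¹ • (volume : Measure (Vec n)).toSphere

/-- The uniform distribution on `{-1, +1}`. -/
def uniformSign : Measure ℝ :=
  (2 : ENNReal)⁻¹ • Measure.dirac 1 + (2 : ENNReal)⁻¹ • Measure.dirac (-1)

/-- The joint law of `(θ⁰, a)`: all `θ⁰_j` uniform on `Gr(1,n)`, all `a_j` uniform on `{-1,+1}`,
everything independent. -/
def initLaw (n m : ℕ) : Measure ((Fin m → Gr1 n) × (Fin m → ℝ)) :=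
  (Measure.pi fun _ : Fin m => uniformGr1 n).prod (Measure.pi fun _ : Fin m => uniformSign)

/-! ### Linear algebra -/

/-- Smallest eigenvalue of a (symmetric) real matrix. -/
def minEig {ι : Type*} [Fintype ι] [DecidableEq ι] (A : Matrix ι ι ℝ) : ℝ :=
  sInf (spectrum ℝ A)

/-- Frobenius norm of a matrix. -/
def frobNorm {ι κ : Type*} [Fintype ι] [Fintype κ] (A : Matrix ι κ ℝ) : ℝ :=
  √(∑ i, ∑ k, A i k ^ 2)

/-- Euclidean norm of a vector with real entries. -/
def vecNorm {ι : Type*} [Fintype ι] (v : ι → ℝ) : ℝ := √(∑ i, v i ^ 2)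

/-- Euclidean distance of two weight vectors in `ℝ^{mn}`. -/
def weightDist {m n : ℕ} (θ θ' : Fin m → Vec n) : ℝ := √(∑ j, ‖θ j - θ' j‖ ^ 2)

/-! ### The two-layer network with batch normalization

Expectation over the input is expectation over the empirical distribution of `x_1, …, x_N`. -/

variable {n N m : ℕ}

/-- `E[x]`. -/
def mean (x : Fin N → Vec n) : Vec n := (N : ℝ)⁻¹ • ∑ i, x i

/-- The covariance matrix `V = E[(x - E[x]) (x - E[x])ᵀ]`. -/
def cov (x : Fin N → Vec n) : Matrix (Fin n) (Fin n) ℝ :=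
  Matrix.of fun k l => (N : ℝ)⁻¹ * ∑ i, (x i - mean x) k * (x i - mean x) l

/-- The vector `V u`. -/
def covMul (x : Fin N → Vec n) (u : Vec n) : Vec n := WithLp.toLp 2 (cov x *ᵥ u.ofLp)

/-- `√(uᵀ V u)`. -/
def stdDev (x : Fin N → Vec n) (u : Vec n) : ℝ := √(inner ℝ u (covMul x u))

/-- The batch-normalized pre-activation `uᵀ (x_i - E[x]) / √(uᵀ V u)`. -/
def preAct (x : Fin N → Vec n) (i : Fin N) (u : Vec n) : ℝ :=
  inner ℝ u (x i - mean x) / stdDev x u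

/-- The ReLU activation. -/
def relu (s : ℝ) : ℝ := max s 0

/-- The output vector `u(θ) = (f(x_1,θ,a), …, f(x_N,θ,a))`. -/
def output (x : Fin N → Vec n) (a : Fin m → ℝ) (θ : Fin m → Vec n) : Fin N → ℝ :=
  fun i => (√(m : ℝ))⁻¹ * ∑ j, a j * relu (preAct x i (θ j))

/-- `φ_i(u) = x_i / √(uᵀVu) - V u uᵀ x_i / (uᵀVu)^{3/2}` (with `x_i` centered), the gradient of the
pre-activation; see `hasGradientAt_preAct`. -/
def preActGrad (x : Fin N → Vec n) (i : Fin N) (u : Vec n) : Vec n :=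
  (stdDev x u)⁻¹ • (x i - mean x) -
    (inner ℝ u (x i - mean x) / stdDev x u ^ 3) • covMul x u

/-- The (generalized) Riemannian Jacobian of the output vector with respect to `θ`, an
`N × (mn)` matrix; the derivative of the ReLU is taken to be the indicator of `[0, ∞)`. The gradients
`φ_i(θ_j)` are already tangent to the sphere at `θ_j`; see `inner_preActGrad`. -/
def jacobian (x : Fin N → Vec n) (a : Fin m → ℝ) (θ : Fin m → Vec n) :
    Matrix (Fin N) (Fin m × Fin n) ℝ :=
  Matrix.of fun i jl => (√(m : ℝ))⁻¹ * a jl.1 *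
    (if 0 ≤ inner ℝ (θ jl.1) (x i - mean x) then 1 else 0) * preActGrad x i (θ jl.1) jl.2

/-- `M = max_i max_{u ∈ Gr(1,n)} ‖φ_i(u)‖²`. -/
def gradBound (x : Fin N → Vec n) : ℝ := ⨆ i : Fin N, ⨆ u : Gr1 n, ‖preActGrad x i u‖ ^ 2

/-- `σ₀ = √(λ_min(J(θ) J(θ)ᵀ))` at `θ = θ⁰`. -/
def sigma0 (x : Fin N → Vec n) (a : Fin m → ℝ) (θ : Fin m → Vec n) : ℝ :=
  √(minEig (jacobian x a θ * (jacobian x a θ)ᵀ))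

/-- The residual norm `‖u(θ) - y‖`. -/
def residual (x : Fin N → Vec n) (y : Fin N → ℝ) (a : Fin m → ℝ) (θ : Fin m → Vec n) : ℝ :=
  vecNorm (output x a θ - y)

/-- Assumptions on the data set: unit inputs, outputs bounded by `B`, inputs pairwise non-parallel,
inputs of mean zero and with positive definite covariance. -/
structure DataAssumption (B : ℝ) (x : Fin N → Vec n) (y : Fin N → ℝ) : Prop where
  nonempty : 0 < N
  unit : ∀ i, ‖x i‖ = 1
  bounded : ∀ i, |y i| ≤ B
  nonparallel : ∀ i j, i ≠ j → x i ≠ x j ∧ x i ≠ -x j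
  mean_zero : mean x = 0
  posDef : (cov x).PosDef

/-- The Riemannian Jacobian stability condition at the initial point `θ₀`. -/
def JacobianStable (μ κL : ℝ) (x : Fin N → Vec n) (y : Fin N → ℝ) (a : Fin m → ℝ)
    (θ₀ : Fin m → Vec n) : Prop :=
  0 < sigma0 x a θ₀ ∧
  ∀ θ : Fin m → Vec n, (∀ j, ‖θ j‖ = 1) →
    weightDist θ θ₀ ≤ 4 * κL * (μ * sigma0 x a θ₀)⁻¹ * residual x y a θ₀ →
    frobNorm (jacobian x a θ - jacobian x a θ₀) ≤ min (1 / 2) (μ / (6 * κL)) * sigma0 x a θ₀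

/-! ### Loss and Fisher information

`p z y` is the conditional density `p(y | z)` of the label `y` given the network output `z`, with
respect to a reference measure `ν` on `ℝ` (for instance Lebesgue or counting measure). -/

/-- The loss `L(z, y) = - log p(y | z)`. -/
def loss (p : ℝ → ℝ → ℝ) (z y : ℝ) : ℝ := -Real.log (p z y)

/-- `∇_z L(z, y)`. -/
def lossGrad (p : ℝ → ℝ → ℝ) (z y : ℝ) : ℝ := deriv (fun w => loss p w y) z

/-- `∇²_{zz} L(z, y)`. -/
def lossHess (p : ℝ → ℝ → ℝ) (z y : ℝ) : ℝ := deriv (fun w => lossGrad p w y) z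

/-- The Fisher information of the output, `E_{y ∼ p(· | z)} [(∇_z log p(y | z))²]`. -/
def fisherLoss (ν : Measure ℝ) (p : ℝ → ℝ → ℝ) (z : ℝ) : ℝ :=
  ∫ y, deriv (fun w => Real.log (p w y)) z ^ 2 * p z y ∂ν

/-- Assumptions on the loss, for the labels `y_1, …, y_N` and for networks of width `m`. -/
structure LossAssumption (μ κL κH : ℝ) (ν : Measure ℝ) (p : ℝ → ℝ → ℝ) (m : ℕ)
    (x : Fin N → Vec n) (y : Fin N → ℝ) : Prop where
  mu_pos : 0 < μ
  kappaL_pos : 0 < κL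
  kappaH_pos : 0 < κH
  density_nonneg : ∀ z w, 0 ≤ p z w
  density_integral : ∀ z, ∫ w, p z w ∂ν = 1
  density_pos : ∀ z i, 0 < p z (y i)
  smooth : ∀ i, ContDiff ℝ 2 fun z => loss p z (y i)
  hess_lower : ∀ i z, μ ≤ lossHess p z (y i)
  hess_upper : ∀ i z, lossHess p z (y i) ≤ κL
  hess_lipschitz : ∀ i z w, |lossHess p z (y i) - lossHess p w (y i)| ≤ κH * |z - w|
  /-- The Fisher information of the output agrees with the Hessian of the loss at all outputs of the
  network. -/
  fisher_eq_hess : ∀ (a : Fin m → ℝ) (θ : Fin m → Vec n),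
    (∀ j, a j = 1 ∨ a j = -1) → (∀ j, ‖θ j‖ = 1) →
    ∀ i, fisherLoss ν p (output x a θ i) = lossHess p (output x a θ i) (y i)
  /-- A perfect prediction is a stationary point of the loss. -/
  grad_label : ∀ i, lossGrad p (y i) (y i) = 0

/-! ### The deterministic Riemannian natural gradient method -/

/-- The pseudo-inverse `Jᵀ (J Jᵀ)⁻¹ H⁻¹ (J Jᵀ)⁻¹ J` of the Riemannian Fisher information matrix
`Jᵀ H J`, where `H` is the diagonal matrix of the Fisher informations of the `N` outputs. -/
def fisherPinv (ν : Measure ℝ) (p : ℝ → ℝ → ℝ) (x : Fin N → Vec n) (a : Fin m → ℝ)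
    (θ : Fin m → Vec n) : Matrix (Fin m × Fin n) (Fin m × Fin n) ℝ :=
  let J := jacobian x a θ
  let H := Matrix.diagonal fun i => fisherLoss ν p (output x a θ i)
  Jᵀ * (J * Jᵀ)⁻¹ * H⁻¹ * (J * Jᵀ)⁻¹ * J

/-- The Riemannian natural gradient direction `d = F^† Jᵀ ∇L(u, y)`. -/
def rngdDirection (ν : Measure ℝ) (p : ℝ → ℝ → ℝ) (x : Fin N → Vec n) (y : Fin N → ℝ)
    (a : Fin m → ℝ) (θ : Fin m → Vec n) : Fin m × Fin n → ℝ :=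
  fisherPinv ν p x a θ *ᵥ ((jacobian x a θ)ᵀ *ᵥ fun i => lossGrad p (output x a θ i) (y i))

/-- The exponential map of the product of unit spheres at `θ`, applied to the tangent vector `ξ`
(`Real.sinc t` is `sin t / t`, extended by `1` at `t = 0`). -/
def sphereExp (θ ξ : Fin m → Vec n) : Fin m → Vec n :=
  fun j => Real.cos ‖ξ j‖ • θ j + Real.sinc ‖ξ j‖ • ξ j

/-- The iterates `θ^{k+1} = exp_{θ^k}(-η d^k)` started at `θ⁰ = θ₀`. -/
def rngd (ν : Measure ℝ) (p : ℝ → ℝ → ℝ) (η : ℝ) (x : Fin N → Vec n) (y : Fin N → ℝ)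
    (a : Fin m → ℝ) (θ₀ : Fin m → Vec n) : ℕ → Fin m → Vec n
  | 0 => θ₀
  | k + 1 =>
    let θ := rngd ν p η x y a θ₀ k
    sphereExp θ fun j => WithLp.toLp 2 fun l => -η * rngdDirection ν p x y a θ (j, l)

/-! ### Sanity checks for the Jacobian -/

theorem inner_covMul_comm (x : Fin N → Vec n) (u v : Vec n) :
    inner ℝ u (covMul x v) = inner ℝ v (covMul x u) := by
  have hs : (cov x)ᵀ = cov x := by
    ext k l
    simp [cov, Matrix.transpose_apply, mul_comm]
  simp only [covMul, EuclideanSpace.inner_eq_star_dotProduct, star_trivial]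
  rw [dotProduct_comm, Matrix.dotProduct_mulVec, ← Matrix.mulVec_transpose, hs]

theorem inner_preActGrad (x : Fin N → Vec n) (i : Fin N) (u : Vec n)
    (hu : 0 < inner ℝ u (covMul x u)) : inner ℝ u (preActGrad x i u) = 0 := by
  have h0 : 0 < stdDev x u := Real.sqrt_pos.2 hu
  have h2 : inner ℝ u (covMul x u) = stdDev x u ^ 2 := (Real.sq_sqrt hu.le).symm
  rw [preActGrad, inner_sub_right, inner_smul_right, inner_smul_right, h2]
  field_simp
  ring

theorem hasGradientAt_preAct (x : Fin N → Vec n) (i : Fin N) (u : Vec n)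
    (hu : 0 < inner ℝ u (covMul x u)) :
    HasGradientAt (preAct x i) (preActGrad x i u) u := by
  have h0 : 0 < stdDev x u := Real.sqrt_pos.2 hu
  let T : Vec n →L[ℝ] Vec n :=
    LinearMap.toContinuousLinearMap
      { toFun := covMul x
        map_add' := fun a b => by simp [covMul, Matrix.mulVec_add]
        map_smul' := fun c a => by simp [covMul, Matrix.mulVec_smul] }
  have hT : HasFDerivAt (covMul x) T u := T.hasFDerivAt
  have hq := ((hasFDerivAt_id u).inner ℝ hT).sqrt hu.ne'
  have hc := (hasFDerivAt_id (𝕜 := ℝ) u).inner ℝ (hasFDerivAt_const (x i - mean x) u)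
  have hd := hc.mul ((hasDerivAt_inv (x := stdDev x u) h0.ne').comp_hasFDerivAt u hq)
  rw [hasGradientAt_iff_hasFDerivAt]
  refine (hd.congr_fderiv ?_)
  ext v
  have hcomm : inner ℝ u (covMul x v) = inner ℝ v (covMul x u) := inner_covMul_comm x u v
  have hTv : T v = covMul x v := rfl
  have hs : √(inner ℝ u (covMul x u)) = stdDev x u := rfl
  simp [preActGrad, hTv, hs, fderivInnerCLM_apply, hcomm]
  rw [real_inner_comm v (covMul x u), ← inner_sub_left, real_inner_comm v (x i - mean x)]
  field_simp
  ring

end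

end RNGD

/-! Both parts rest on one estimate: with high probability the Jacobian varies little on a ball
around the initialization. A block of the Jacobian changes either smoothly, which the Lipschitz
constant controls, or because a neuron crosses the hyperplane orthogonal to some `x i`. A crossing
needs the neuron to start within δ of the hyperplane or to move by at least δ. The first is rare by
anti-concentration on the sphere, `uniformGr1_abs_inner_le`, and Markov; the second is paid for by
the squared displacement. The smooth term also needs an upper bound on the scale τ, which comes from
bounding `sigma0 ^ 2` by the average of `1 / (θ_jᵀ V θ_j)`, a quantity with a finite mean.
`DataAssumption.exists_event_frobNorm_jacobian_sub_le` combines these.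

The width condition involves the random `sigma0`, while the event must be chosen at a deterministic
scale. `exists_width_threshold` solves `m * s ^ 8 = K` for `s`: the condition then says exactly that
`sigma0` is at least `s`, and the estimate is used at `τ = c * s`. Stability follows once the
initial residual is bounded. In the first part this is Markov applied to its second moment, at most
`2 * (1 + B ^ 2) * N` because the random signs kill cross terms and batch normalization bounds the
sum of squared activations; in the second part it is a hypothesis.

Convergence is then deterministic (`rngd_step`). While the Jacobian stays close to the initial one,
it keeps full row rank and the natural gradient direction is the minimal-norm preimage of the Newton
direction in output space. The new residual is `(1 - η)` times the old one plus three errors: the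
Newton error from the Lipschitz Hessian, the Jacobian variation along the geodesic, and the
curvature of the geodesic. Although the ReLU has a kink, the output change is still the integral of
Jacobian times velocity, since only countably many times are exceptional. The sum of distance
travelled and a multiple of the residual never increases, which keeps all iterates in the ball. -/

namespace RNGD

variable {n N m : ℕ}

/-! ### Smallest eigenvalues and the covariance form -/

open scoped Pointwise in
theorem posSemidef_sub_minEig {ι : Type*} [Fintype ι] [DecidableEq ι] {A : Matrix ι ι ℝ}
    (hA : A.IsHermitian) : (A - minEig A • (1 : Matrix ι ι ℝ)).PosSemidef := by
  have h1 : (A - minEig A • (1 : Matrix ι ι ℝ)).IsHermitian :=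
    hA.sub (by simp [Matrix.IsHermitian])
  rw [h1.posSemidef_iff_eigenvalues_nonneg]
  intro i
  have h2 : h1.eigenvalues i ∈ spectrum ℝ (A - minEig A • (1 : Matrix ι ι ℝ)) := by
    rw [h1.spectrum_real_eq_range_eigenvalues]; exact ⟨i, rfl⟩
  have h3 : spectrum ℝ (A - minEig A • (1 : Matrix ι ι ℝ)) = spectrum ℝ A - ({minEig A} : Set ℝ) := by
    rw [← Algebra.algebraMap_eq_smul_one, spectrum.sub_singleton_eq]
  rw [h3] at h2
  obtain ⟨s, hs, t, ht, hst⟩ := Set.mem_sub.1 h2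
  have hb : BddBelow (spectrum ℝ A) := by
    rw [hA.spectrum_real_eq_range_eigenvalues]; exact (Set.finite_range _).bddBelow
  have : minEig A ≤ s := csInf_le hb hs
  rw [Set.mem_singleton_iff] at ht
  simp only [Pi.zero_apply]
  linarith

theorem minEig_mul_le {ι : Type*} [Fintype ι] [DecidableEq ι] {A : Matrix ι ι ℝ}
    (hA : A.IsHermitian) (v : ι → ℝ) : minEig A * (v ⬝ᵥ v) ≤ v ⬝ᵥ (A *ᵥ v) := by
  have h := (posSemidef_sub_minEig hA).dotProduct_mulVec_nonneg v
  rw [Matrix.sub_mulVec, dotProduct_sub, Matrix.smul_mulVec, Matrix.one_mulVec, star_trivial,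
    dotProduct_smul, smul_eq_mul] at h
  linarith

theorem exists_eigenvector_minEig {ι : Type*} [Fintype ι] [DecidableEq ι] [Nonempty ι]
    {A : Matrix ι ι ℝ} (hA : A.IsHermitian) :
    ∃ v : EuclideanSpace ℝ ι, ‖v‖ = 1 ∧ A *ᵥ v.ofLp = minEig A • v.ofLp := by
  have h : minEig A ∈ Set.range hA.eigenvalues := by
    rw [minEig, hA.spectrum_real_eq_range_eigenvalues]
    exact (Set.range_nonempty _).csInf_mem (Set.finite_range _)
  obtain ⟨i, hi⟩ := h
  refine ⟨hA.eigenvectorBasis i, hA.eigenvectorBasis.orthonormal.1 i, ?_⟩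
  rw [← hi]
  exact hA.mulVec_eigenvectorBasis i

theorem inner_eq_dotProduct (u v : Vec n) : inner ℝ u v = u.ofLp ⬝ᵥ v.ofLp := by
  rw [EuclideanSpace.inner_eq_star_dotProduct, star_trivial, dotProduct_comm]

theorem isHermitian_cov (x : Fin N → Vec n) : (cov x).IsHermitian := by
  ext k l
  simp [cov, mul_comm]

theorem covMul_eq_sum (x : Fin N → Vec n) (u : Vec n) :
    covMul x u = (N : ℝ)⁻¹ • ∑ i, (inner ℝ u (x i - mean x) : ℝ) • (x i - mean x) := by
  ext k
  simp only [covMul, cov, Matrix.mulVec, dotProduct, Matrix.of_apply, PiLp.smul_apply,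
    WithLp.ofLp_sum, Finset.sum_apply, smul_eq_mul, inner_eq_dotProduct, Finset.sum_mul,
    Finset.mul_sum]
  rw [Finset.sum_comm]
  refine Finset.sum_congr rfl fun i _ => ?_
  refine Finset.sum_congr rfl fun l _ => ?_
  ring

theorem inner_covMul_eq_sum (x : Fin N → Vec n) (u v : Vec n) :
    inner ℝ v (covMul x u) =
      (N : ℝ)⁻¹ * ∑ i, (inner ℝ u (x i - mean x) : ℝ) * inner ℝ v (x i - mean x) := by
  rw [covMul_eq_sum, inner_smul_right, inner_sum]
  simp only [inner_smul_right]

theorem minEig_cov_mul_le (x : Fin N → Vec n) (u : Vec n) :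
    minEig (cov x) * ‖u‖ ^ 2 ≤ inner ℝ u (covMul x u) := by
  rw [← real_inner_self_eq_norm_sq, inner_eq_dotProduct, inner_eq_dotProduct]
  exact minEig_mul_le (isHermitian_cov x) _

/-- Expanding the square, the sums over the data of `⟪u, x_i⟫ ^ 2` and `⟪u, x_i⟫ * ⟪V u, x_i⟫` are
again values of the covariance form. Dropping the negative term gives an upper bound; keeping it
gives the exact value at an eigenvector, needed in `inv_minEig_le`. -/
theorem sum_norm_preActGrad_sq (x : Fin N → Vec n) (u : Vec n) (hN : 0 < N)
    (hu : 0 < inner ℝ u (covMul x u)) :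
    ∑ i, ‖preActGrad x i u‖ ^ 2 = (∑ i, ‖x i - mean x‖ ^ 2) / inner ℝ u (covMul x u)
      - N * ‖covMul x u‖ ^ 2 / (inner ℝ u (covMul x u)) ^ 2 := by
  have hN' : (N : ℝ) ≠ 0 := by positivity
  have h0 : 0 < stdDev x u := Real.sqrt_pos.2 hu
  have h2 : inner ℝ u (covMul x u) = stdDev x u ^ 2 := (Real.sq_sqrt hu.le).symm
  have e1 : ∑ i, (inner ℝ u (x i - mean x) : ℝ) * inner ℝ (covMul x u) (x i - mean x)
      = N * ‖covMul x u‖ ^ 2 := by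
    have := inner_covMul_eq_sum x u (covMul x u)
    rw [real_inner_self_eq_norm_sq] at this
    rw [this]; field_simp
  have e2 : ∑ i, (inner ℝ u (x i - mean x) : ℝ) ^ 2 = N * stdDev x u ^ 2 := by
    have := inner_covMul_eq_sum x u u
    rw [← h2, this]; field_simp
  rw [h2]
  have e3 : ∀ i, ‖preActGrad x i u‖ ^ 2 = ‖x i - mean x‖ ^ 2 / stdDev x u ^ 2
      - 2 / stdDev x u ^ 4 * ((inner ℝ u (x i - mean x) : ℝ) * inner ℝ (covMul x u) (x i - mean x))
      + ‖covMul x u‖ ^ 2 / stdDev x u ^ 6 * (inner ℝ u (x i - mean x) : ℝ) ^ 2 := by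
    intro i
    rw [preActGrad, norm_sub_sq_real, norm_smul, norm_smul, inner_smul_left, inner_smul_right,
      real_inner_comm (covMul x u), mul_pow, mul_pow, Real.norm_eq_abs, Real.norm_eq_abs, sq_abs, sq_abs]
    simp only [conj_trivial]
    field_simp
  simp only [e3, Finset.sum_add_distrib, Finset.sum_sub_distrib, ← Finset.mul_sum, e1, e2,
    ← Finset.sum_div]
  field_simp
  ring

theorem sum_norm_preActGrad_sq_le (x : Fin N → Vec n) (u : Vec n) (hN : 0 < N)
    (hx : ∑ i, ‖x i - mean x‖ ^ 2 = N) (hu : 0 < inner ℝ u (covMul x u)) :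
    ∑ i, ‖preActGrad x i u‖ ^ 2 ≤ N / inner ℝ u (covMul x u) := by
  rw [sum_norm_preActGrad_sq x u hN hu, hx]
  have : 0 ≤ N * ‖covMul x u‖ ^ 2 / (inner ℝ u (covMul x u)) ^ 2 := by positivity
  linarith

namespace DataAssumption
variable {B : ℝ} {x : Fin N → Vec n} {y : Fin N → ℝ}

theorem sum_norm_sq (h : DataAssumption B x y) : ∑ i, ‖x i - mean x‖ ^ 2 = N := by
  simp [h.mean_zero, h.unit]

/-- With zero mean, one input would vanish and two inputs would be antipodal. -/
theorem three_le_card (h : DataAssumption B x y) : 3 ≤ N := by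
  have h0 := h.nonempty
  have hm := h.mean_zero
  by_contra hN
  obtain rfl | rfl : N = 1 ∨ N = 2 := by omega
  · have := h.unit 0
    simp [mean] at hm
    simp [hm] at this
  · simp only [mean, smul_eq_zero, Fin.sum_univ_two] at hm
    have h3 := hm.resolve_left (by norm_num)
    exact (h.nonparallel 0 1 (by decide)).2 (eq_neg_of_add_eq_zero_left h3)

theorem two_le_dim (h : DataAssumption B x y) : 2 ≤ n := by
  have hN := h.three_le_card
  by_contra hn
  obtain rfl | rfl : n = 0 ∨ n = 1 := by omega
  · have := h.unit ⟨0, by omega⟩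
    rw [Subsingleton.elim (x _) 0] at this
    simp at this
  · have hx : ∀ i, x i 0 = 1 ∨ x i 0 = -1 := by
      intro i
      have := h.unit i
      rw [EuclideanSpace.norm_eq, Real.sqrt_eq_one] at this
      simpa using this
    have hne := h.nonparallel ⟨0, by omega⟩ ⟨1, by omega⟩ (by simp)
    have ext1 : ∀ u v : Vec 1, u 0 = v 0 → u = v := fun u v huv => by
      ext k; rw [Subsingleton.elim k 0, huv]
    rcases hx ⟨0, by omega⟩ with h0 | h0 <;> rcases hx ⟨1, by omega⟩ with h1 | h1
    · exact hne.1 (ext1 _ _ (by rw [h0, h1]))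
    · exact hne.2 (ext1 _ _ (by simp [h0, h1]))
    · exact hne.2 (ext1 _ _ (by simp [h0, h1]))
    · exact hne.1 (ext1 _ _ (by rw [h0, h1]))

theorem minEig_pos (h : DataAssumption B x y) : 0 < minEig (cov x) := by
  have : Nonempty (Fin n) := ⟨⟨0, by have := h.two_le_dim; omega⟩⟩
  obtain ⟨v, hv, hve⟩ := exists_eigenvector_minEig (isHermitian_cov x)
  have h1 := h.posDef.dotProduct_mulVec_pos (x := v.ofLp) (by
    intro h0
    have : v = 0 := by ext k; simp [h0]
    simp [this] at hv)
  rw [hve, star_trivial, dotProduct_smul, ← inner_eq_dotProduct, real_inner_self_eq_norm_sq, hv] at h1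
  simpa using h1

theorem inner_covMul_pos (h : DataAssumption B x y) (u : Vec n) (hu : ‖u‖ = 1) :
    0 < inner ℝ u (covMul x u) := by
  have h1 := minEig_cov_mul_le x u
  rw [hu] at h1
  linarith [h.minEig_pos]

/-- The trace of `V` is 1, as the inputs are centered unit vectors, and every diagonal entry is at
least the smallest eigenvalue. -/
theorem dim_mul_minEig_le (h : DataAssumption B x y) : n * minEig (cov x) ≤ 1 := by
  have hN : (N : ℝ) ≠ 0 := by have := h.nonempty; positivity
  have h1 : ∀ k : Fin n, minEig (cov x) ≤ (N : ℝ)⁻¹ * ∑ i, x i k ^ 2 := by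
    intro k
    have := minEig_cov_mul_le x (EuclideanSpace.single k (1 : ℝ))
    rw [inner_covMul_eq_sum] at this
    simpa [h.mean_zero, EuclideanSpace.inner_single_left, pow_two] using this
  have h2 := Finset.sum_le_sum fun k (_ : k ∈ Finset.univ) => h1 k
  rw [← Finset.mul_sum, Finset.sum_comm] at h2
  have h3 : ∀ i, ∑ k, x i k ^ 2 = 1 := by
    intro i
    have := h.unit i
    rw [EuclideanSpace.norm_eq, Real.sqrt_eq_one] at this
    simpa using this
  simp [h3] at h2
  rwa [inv_mul_cancel₀ hN] at h2

theorem norm_preActGrad_sq_le (h : DataAssumption B x y) (i : Fin N) (u : Vec n) (hu : ‖u‖ = 1) :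
    ‖preActGrad x i u‖ ^ 2 ≤ gradBound x := by
  have hb : ∀ (i : Fin N) (v : Gr1 n), ‖preActGrad x i v‖ ^ 2 ≤ N / minEig (cov x) := by
    intro i v
    have hv : ‖(v : Vec n)‖ = 1 := by simp
    have hp := h.inner_covMul_pos v hv
    refine (Finset.single_le_sum (fun i _ => sq_nonneg ‖preActGrad x i v‖)
      (Finset.mem_univ i)).trans
      ((sum_norm_preActGrad_sq_le x v h.nonempty h.sum_norm_sq hp).trans ?_)
    have h1 := minEig_cov_mul_le x v
    rw [hv] at h1
    have := h.minEig_pos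
    gcongr
    linarith
  have h1 : BddAbove (Set.range fun v : Gr1 n => ‖preActGrad x i v‖ ^ 2) :=
    ⟨_, by rintro _ ⟨v, rfl⟩; exact hb i v⟩
  refine (le_ciSup h1 ⟨u, by simpa using hu⟩).trans ?_
  exact le_ciSup (f := fun i : Fin N => ⨆ v : Gr1 n, ‖preActGrad x i v‖ ^ 2)
    (Set.finite_range _).bddAbove i

/-- At a unit eigenvector for the smallest eigenvalue σ the mean of `‖φ_i‖ ^ 2` is exactly `1/σ -
1`. Since `n * σ ≤ 1` and `n ≥ 2`, the subtracted 1 is at most half of `1/σ`. This lets `L + 2 *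
gradBound x` dominate `1/σ` in the width bounds. -/
theorem inv_minEig_le (h : DataAssumption B x y) : (minEig (cov x))⁻¹ ≤ 2 * gradBound x := by
  have hn := h.two_le_dim
  have hN : (0 : ℝ) < N := by have := h.nonempty; positivity
  have : Nonempty (Fin n) := ⟨⟨0, by omega⟩⟩
  obtain ⟨v, hv, hve⟩ := exists_eigenvector_minEig (isHermitian_cov x)
  have hs := h.minEig_pos
  have hc : covMul x v = minEig (cov x) • v := by
    rw [covMul, hve]; rfl
  have hq : inner ℝ v (covMul x v) = minEig (cov x) := by
    rw [hc, inner_smul_right, real_inner_self_eq_norm_sq, hv]; simp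
  have h1 := sum_norm_preActGrad_sq x v h.nonempty (by rw [hq]; exact hs)
  have h2 : ∑ i, ‖preActGrad x i v‖ ^ 2 ≤ N * gradBound x := by
    refine (Finset.sum_le_sum fun i _ => h.norm_preActGrad_sq_le i v hv).trans ?_
    simp
  rw [h1, h.sum_norm_sq, hq, hc, norm_smul, hv, mul_one, Real.norm_eq_abs, sq_abs] at h2
  have h3 : (N : ℝ) / minEig (cov x) - N * minEig (cov x) ^ 2 / minEig (cov x) ^ 2
      = N * ((minEig (cov x))⁻¹ - 1) := by field_simp
  rw [h3] at h2
  have h4 := le_of_mul_le_mul_left h2 hN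
  have h5 : minEig (cov x) ≤ 1 / 2 := by
    have h6 := h.dim_mul_minEig_le
    have : (2 : ℝ) ≤ n := by exact_mod_cast hn
    nlinarith
  have h7 : 2 ≤ (minEig (cov x))⁻¹ := by
    rw [le_inv_comm₀ (by norm_num) hs]; linarith
  linarith

end DataAssumption

theorem sum_sq_eq_dotProduct {ι : Type*} [Fintype ι] (v : ι → ℝ) : ∑ i, v i ^ 2 = v ⬝ᵥ v := by
  simp [dotProduct, pow_two]

theorem sigma0_sq_mul_le (x : Fin N → Vec n) (a : Fin m → ℝ) (θ : Fin m → Vec n) (v : Fin N → ℝ) :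
    sigma0 x a θ ^ 2 * ∑ i, v i ^ 2 ≤ ∑ p, ((jacobian x a θ)ᵀ *ᵥ v) p ^ 2 := by
  have hv : 0 ≤ ∑ i, v i ^ 2 := by positivity
  rcases le_total 0 (minEig (jacobian x a θ * (jacobian x a θ)ᵀ)) with h | h
  · rw [sigma0, Real.sq_sqrt h, sum_sq_eq_dotProduct, sum_sq_eq_dotProduct]
    refine (minEig_mul_le ?_ v).trans_eq ?_
    · simpa using Matrix.isHermitian_mul_conjTranspose_self (jacobian x a θ)
    · rw [← Matrix.mulVec_mulVec, Matrix.dotProduct_mulVec, ← Matrix.mulVec_transpose]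
  · rw [sigma0, Real.sqrt_eq_zero_of_nonpos h]
    simp only [ne_eq, OfNat.ofNat_ne_zero, not_false_eq_true, zero_pow, zero_mul]
    positivity

theorem sign_sq {b : ℝ} (h : b = 1 ∨ b = -1) : b ^ 2 = 1 := by
  rcases h with rfl | rfl <;> norm_num

/-- The smallest eigenvalue of `J Jᵀ` is at most each squared row norm, hence at most their average
over the data; indicators are bounded by 1 and the sum over data points is
`sum_norm_preActGrad_sq_le`. -/
theorem DataAssumption.sigma0_sq_le {B : ℝ} {x : Fin N → Vec n} {y : Fin N → ℝ}
    (h : DataAssumption B x y) {a : Fin m → ℝ} (ha : ∀ j, a j = 1 ∨ a j = -1)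
    {θ : Fin m → Vec n} (hθ : ∀ j, ‖θ j‖ = 1) :
    sigma0 x a θ ^ 2 ≤ (m : ℝ)⁻¹ * ∑ j, (inner ℝ (θ j) (covMul x (θ j)))⁻¹ := by
  have hN : (0 : ℝ) < N := by have := h.nonempty; positivity
  have h1 : ∀ i : Fin N, sigma0 x a θ ^ 2 ≤ ∑ p, jacobian x a θ i p ^ 2 := by
    intro i
    have := sigma0_sq_mul_le x a θ (Pi.single i 1)
    simpa [Pi.single_apply, Matrix.transpose_apply] using this
  have h2 : ∀ i : Fin N, ∑ p, jacobian x a θ i p ^ 2 ≤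
      (m : ℝ)⁻¹ * ∑ j, ‖preActGrad x i (θ j)‖ ^ 2 := by
    intro i
    rw [Fintype.sum_prod_type, Finset.mul_sum]
    refine Finset.sum_le_sum fun j _ => ?_
    rw [EuclideanSpace.norm_sq_eq, Finset.mul_sum]
    refine Finset.sum_le_sum fun l _ => ?_
    simp only [jacobian, Matrix.of_apply, mul_pow, sign_sq (ha j), inv_pow,
      Real.sq_sqrt (Nat.cast_nonneg m), mul_one, Real.norm_eq_abs, sq_abs]
    split_ifs
    · simp
    · simp only [ne_eq, OfNat.ofNat_ne_zero, not_false_eq_true, zero_pow, mul_zero, zero_mul]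
      positivity
  have h3 := Finset.sum_le_sum fun i (_ : i ∈ Finset.univ) => (h1 i).trans (h2 i)
  rw [← Finset.mul_sum, Finset.sum_comm] at h3
  have h4 : ∑ j, ∑ i, ‖preActGrad x i (θ j)‖ ^ 2 ≤
      ∑ j, N * (inner ℝ (θ j) (covMul x (θ j)))⁻¹ :=
    Finset.sum_le_sum fun j _ => by
      rw [← div_eq_mul_inv]
      exact sum_norm_preActGrad_sq_le x _ h.nonempty h.sum_norm_sq
        (h.inner_covMul_pos _ (hθ j))
  rw [← Finset.mul_sum] at h4
  have h5 := h3.trans (mul_le_mul_of_nonneg_left h4 (by positivity))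
  simp only [Finset.sum_const, Finset.card_univ, Fintype.card_fin, nsmul_eq_mul] at h5
  refine le_of_mul_le_mul_left (h5.trans_eq ?_) hN
  ring

/-! ### Anti-concentration on the sphere -/

theorem volume_slab_le {k : ℕ} (t : ℝ) :
    volume {v : Fin (k + 1) → ℝ | ∑ i, v i ^ 2 < 1 ∧ |v 0| ≤ t} ≤
      ENNReal.ofReal (2 * t) * volume {v : Fin k → ℝ | ∑ i, v i ^ 2 < 1} := by
  have hmp := volume_preserving_piFinSuccAbove (fun _ : Fin (k + 1) => ℝ) 0
  have hsub : {v : Fin (k + 1) → ℝ | ∑ i, v i ^ 2 < 1 ∧ |v 0| ≤ t} ⊆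
      MeasurableEquiv.piFinSuccAbove (fun _ => ℝ) 0 ⁻¹'
        (Set.Icc (-t) t ×ˢ {v : Fin k → ℝ | ∑ i, v i ^ 2 < 1}) := by
    rintro v ⟨h1, h2⟩
    refine ⟨abs_le.1 h2, ?_⟩
    rw [Fin.sum_univ_succ] at h1
    simp only [MeasurableEquiv.piFinSuccAbove_apply, Fin.insertNthEquiv_zero, Set.mem_ofPred_eq,
      Fin.consEquiv_symm_apply, Fin.tail]
    nlinarith [sq_nonneg (v 0)]
  refine (measure_mono hsub).trans ?_
  rw [hmp.measure_preimage_equiv, Measure.volume_eq_prod, Measure.prod_prod, Real.volume_Icc]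
  gcongr
  linarith

/-- A cylinder of half-height `h` and radius `r` fits inside the unit ball. With the cylinder around
the slab in `volume_slab_le`, this compares slab and ball without evaluating any ball volume. -/
theorem volume_le_ball {k : ℕ} (h r : ℝ) (hh : 0 ≤ h) (hr : 0 < r) (hhr : h ^ 2 + r ^ 2 ≤ 1) :
    ENNReal.ofReal (2 * h * r ^ k) * volume {v : Fin k → ℝ | ∑ i, v i ^ 2 < 1} ≤
      volume {v : Fin (k + 1) → ℝ | ∑ i, v i ^ 2 < 1} := by
  have hmp := volume_preserving_piFinSuccAbove (fun _ : Fin (k + 1) => ℝ) 0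
  have hsub : MeasurableEquiv.piFinSuccAbove (fun _ => ℝ) 0 ⁻¹'
        (Set.Icc (-h) h ×ˢ {v : Fin k → ℝ | ∑ i, v i ^ 2 < r ^ 2}) ⊆
      {v : Fin (k + 1) → ℝ | ∑ i, v i ^ 2 < 1} := by
    rintro v ⟨h1, h2⟩
    simp only [MeasurableEquiv.piFinSuccAbove_apply, Fin.insertNthEquiv_zero, Set.mem_ofPred_eq,
      Fin.consEquiv_symm_apply, Fin.tail] at h1 h2 ⊢
    rw [Fin.sum_univ_succ]
    have : v 0 ^ 2 ≤ h ^ 2 := sq_le_sq' h1.1 h1.2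
    linarith
  have hsm : {v : Fin k → ℝ | ∑ i, v i ^ 2 < r ^ 2} =
      (fun v : Fin k → ℝ => r⁻¹ • v) ⁻¹' {v : Fin k → ℝ | ∑ i, v i ^ 2 < 1} := by
    ext v
    simp only [Set.mem_ofPred_eq, Set.mem_preimage, Pi.smul_apply, smul_eq_mul, mul_pow,
      ← Finset.mul_sum]
    rw [inv_pow, inv_mul_lt_iff₀ (by positivity), mul_one]
  have hvol : volume {v : Fin k → ℝ | ∑ i, v i ^ 2 < r ^ 2} =
      ENNReal.ofReal (r ^ k) * volume {v : Fin k → ℝ | ∑ i, v i ^ 2 < 1} := by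
    rw [hsm, Measure.addHaar_preimage_smul _ (inv_ne_zero hr.ne')]
    simp [abs_of_pos hr]
  refine le_trans ?_ (measure_mono hsub)
  rw [hmp.measure_preimage_equiv, Measure.volume_eq_prod, Measure.prod_prod, Real.volume_Icc, hvol,
    ← mul_assoc, ← ENNReal.ofReal_mul (by linarith)]
  gcongr
  linarith

theorem volume_slab_le_mul_ball {k : ℕ} (hk : 1 ≤ k) (t : ℝ) (ht : 0 ≤ t) :
    volume {v : Fin (k + 1) → ℝ | ∑ i, v i ^ 2 < 1 ∧ |v 0| ≤ t} ≤
      ENNReal.ofReal (2 * √((k + 1 : ℕ) : ℝ) * t) *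
        volume {v : Fin (k + 1) → ℝ | ∑ i, v i ^ 2 < 1} := by
  have hk' : (1 : ℝ) ≤ k := by exact_mod_cast hk
  set s := √((k + 1 : ℕ) : ℝ)
  have hs2 : s ^ 2 = k + 1 := by rw [Real.sq_sqrt (by positivity)]; push_cast; ring
  have hs : 0 < s := Real.sqrt_pos.2 (by positivity)
  -- With half-height `1/√(k+1)` this radius makes the cylinder touch the sphere, and `r ^ k ≥ 1/2`
  -- because `(1 + 1/k) ^ k ≤ e ≤ 4`. The price against the ideal ratio is only a factor 2.
  set r := √((k : ℝ) / (k + 1))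
  have hr : 0 < r := Real.sqrt_pos.2 (by positivity)
  have hr2 : r ^ 2 = k / (k + 1) := Real.sq_sqrt (by positivity)
  have hrk : 1 / 2 ≤ r ^ k := by
    have h1 : (1 / 4 : ℝ) ≤ (r ^ k) ^ 2 := by
      rw [← pow_mul, mul_comm, pow_mul, hr2]
      have h2 : ((k : ℝ) / (k + 1)) ^ k = ((1 + 1 / (k : ℝ)) ^ k)⁻¹ := by
        rw [← inv_pow]; congr 1; field_simp
      have h3 : (1 + 1 / (k : ℝ)) ^ k ≤ 4 := by
        have h4 : (1 + 1 / (k : ℝ)) ≤ Real.exp (1 / k) := by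
          linarith [Real.add_one_le_exp (1 / (k : ℝ))]
        calc (1 + 1 / (k : ℝ)) ^ k ≤ Real.exp (1 / k) ^ k := by gcongr
          _ = Real.exp 1 := by rw [← Real.exp_nat_mul]; congr 1; field_simp
          _ ≤ 4 := by linarith [Real.exp_one_lt_d9]
      rw [h2, one_div]
      gcongr
    have h5 : 0 < r ^ k := by positivity
    nlinarith
  have key := volume_le_ball (k := k) (1 / s) r (by positivity) hr
    (by rw [div_pow, hs2, hr2]; field_simp; linarith)
  refine (volume_slab_le t).trans ?_
  calc _ ≤ ENNReal.ofReal (2 * s * t) * (ENNReal.ofReal (2 * (1 / s) * r ^ k) *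
        volume {v : Fin k → ℝ | ∑ i, v i ^ 2 < 1}) := by
        rw [← mul_assoc, ← ENNReal.ofReal_mul (by positivity)]
        refine mul_le_mul' (ENNReal.ofReal_le_ofReal ?_) le_rfl
        have : 2 * s * t * (2 * (1 / s) * r ^ k) = 4 * t * r ^ k := by field_simp; ring
        rw [this]
        nlinarith
    _ ≤ _ := by gcongr

/-- Rotation invariance: an orthonormal basis whose first vector is `x` turns the slab into a
coordinate slab. -/
theorem volume_slab_inner_le (hn : 2 ≤ n) (x : Vec n) (hx : ‖x‖ = 1) (t : ℝ) (ht : 0 ≤ t) :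
    volume {v : Vec n | ‖v‖ < 1 ∧ |inner ℝ x v| ≤ t} ≤
      ENNReal.ofReal (2 * √(n : ℝ) * t) * volume (Metric.ball (0 : Vec n) 1) := by
  obtain ⟨k, rfl⟩ : ∃ k, n = k + 1 := ⟨n - 1, by omega⟩
  obtain ⟨b, hb⟩ := Orthonormal.exists_orthonormalBasis_extension_of_card_eq (𝕜 := ℝ)
    (E := Vec (k + 1)) (ι := Fin (k + 1)) (by simp) (v := fun _ => x) (s := {0}) (by
      rw [orthonormal_iff_ite]
      rintro ⟨i, rfl⟩ ⟨j, rfl⟩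
      simp [hx])
  have hb0 : b 0 = x := hb 0 rfl
  have hmp := (PiLp.volume_preserving_ofLp (Fin (k + 1))).comp b.measurePreserving_repr
  have hsq : ∀ v : Vec (k + 1), ‖v‖ < 1 ↔ ∑ i, (b.repr v) i ^ 2 < 1 := by
    intro v
    rw [← b.repr.norm_map, ← sq_lt_one_iff₀ (norm_nonneg _), EuclideanSpace.norm_sq_eq]
    simp
  have e1 : {v : Vec (k + 1) | ‖v‖ < 1 ∧ |inner ℝ x v| ≤ t} =
      (WithLp.ofLp ∘ b.repr) ⁻¹' {v : Fin (k + 1) → ℝ | ∑ i, v i ^ 2 < 1 ∧ |v 0| ≤ t} := by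
    ext v
    simp only [Set.mem_ofPred_eq, Set.mem_preimage, hsq, Function.comp]
    rw [b.repr_apply_apply, hb0]
  have e2 : Metric.ball (0 : Vec (k + 1)) 1 =
      (WithLp.ofLp ∘ b.repr) ⁻¹' {v : Fin (k + 1) → ℝ | ∑ i, v i ^ 2 < 1} := by
    ext v
    simp only [Metric.mem_ball, dist_zero_right, Set.mem_ofPred_eq, Set.mem_preimage, hsq,
      Function.comp]
  have m2 : MeasurableSet {v : Fin (k + 1) → ℝ | ∑ i, v i ^ 2 < 1} :=
    measurableSet_lt (by fun_prop) (by fun_prop)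
  have m1 : MeasurableSet {v : Fin (k + 1) → ℝ | ∑ i, v i ^ 2 < 1 ∧ |v 0| ≤ t} :=
    m2.inter (measurableSet_le (f := fun v : Fin (k + 1) → ℝ => |v 0|) (g := fun _ => t)
      (by fun_prop) (by fun_prop))
  rw [e1, e2, hmp.measure_preimage m1.nullMeasurableSet, hmp.measure_preimage m2.nullMeasurableSet]
  exact volume_slab_le_mul_ball (by omega) t ht

theorem toSphere_univ_ne_zero (hn : 0 < n) :
    (volume : Measure (Vec n)).toSphere Set.univ ≠ 0 := by
  rw [Measure.toSphere_apply_univ]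
  refine mul_ne_zero (by simp; omega) (Metric.measure_ball_pos _ _ one_pos).ne'

theorem isProbabilityMeasure_uniformGr1 (hn : 0 < n) : IsProbabilityMeasure (uniformGr1 n) :=
  ⟨by
    rw [uniformGr1, Measure.smul_apply, smul_eq_mul]
    exact ENNReal.inv_mul_cancel (toSphere_univ_ne_zero hn) (measure_ne_top _ _)⟩

theorem isProbabilityMeasure_uniformSign : IsProbabilityMeasure uniformSign :=
  ⟨by simp [uniformSign, ENNReal.inv_two_add_inv_two]⟩

theorem uniformGr1_abs_inner_le (hn : 2 ≤ n) (x : Vec n) (hx : ‖x‖ = 1) (t : ℝ) (ht : 0 ≤ t) :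
    uniformGr1 n {w | |inner ℝ (w : Vec n) x| ≤ t} ≤ ENNReal.ofReal (2 * √(n : ℝ) * t) := by
  have hms : MeasurableSet {w : Gr1 n | |inner ℝ (w : Vec n) x| ≤ t} :=
    measurableSet_le (by fun_prop) (by fun_prop)
  rw [uniformGr1, Measure.smul_apply, smul_eq_mul]
  rw [ENNReal.inv_mul_le_iff (toSphere_univ_ne_zero (by omega)) (measure_ne_top _ _),
    Measure.toSphere_apply' _ hms, Measure.toSphere_apply_univ, mul_assoc]
  gcongr
  rw [mul_comm]
  -- Surface measure is `n` times the volume of the cone with radii in `(0, 1)`; shrinking a vector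
  -- shrinks its inner product, so this cone lies in the slab.
  refine le_trans (measure_mono ?_) (volume_slab_inner_le hn x hx t ht)
  rintro _ ⟨r, hr, _, ⟨w, hw, rfl⟩, rfl⟩
  have hw1 : ‖(w : Vec n)‖ = 1 := by simp
  simp only [Set.mem_ofPred_eq] at hw
  rw [real_inner_comm] at hw
  refine ⟨?_, ?_⟩
  · simp only [norm_smul, hw1, mul_one, Real.norm_eq_abs, abs_of_pos hr.1]
    exact hr.2
  · simp only [inner_smul_right, abs_mul, abs_of_pos hr.1]
    have := abs_nonneg (inner ℝ x (w : Vec n))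
    nlinarith [hr.1, hr.2]

/-! ### Moments under the initial distribution -/

/-- Layer-cake formula. The tail `t ^ (-1/2)` is integrable at 0 but not at infinity, so the
pointwise bound `b` is needed to cut the integral off. -/
theorem lintegral_le_of_meas_le_rpow {Ω : Type*} [MeasurableSpace Ω] {P : Measure Ω} {f : Ω → ℝ}
    (hf : Measurable f) (hf0 : ∀ w, 0 ≤ f w) {b K : ℝ} (hb : 0 < b) (hK : 0 ≤ K)
    (hfb : ∀ w, f w ≤ b)
    (h : ∀ t, 0 < t → P {w | t ≤ f w} ≤ ENNReal.ofReal (K * t ^ (-(1 / 2) : ℝ))) :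
    ∫⁻ w, ENNReal.ofReal (f w) ∂P ≤ ENNReal.ofReal (2 * K * √b) := by
  rw [lintegral_eq_lintegral_meas_le P (Filter.Eventually.of_forall hf0) hf.aemeasurable]
  have hint : IntervalIntegrable (fun t : ℝ => K * t ^ (-(1 / 2) : ℝ)) volume 0 b :=
    (intervalIntegral.intervalIntegrable_rpow' (by norm_num)).const_mul K
  have hval : ∫ t in (0 : ℝ)..b, K * t ^ (-(1 / 2) : ℝ) = 2 * K * √b := by
    rw [intervalIntegral.integral_const_mul, integral_rpow (Or.inl (by norm_num)),
      Real.sqrt_eq_rpow, Real.zero_rpow (by norm_num)]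
    norm_num
    ring
  rw [← hval, intervalIntegral.integral_of_le hb.le]
  rw [ofReal_integral_eq_lintegral_ofReal ((intervalIntegrable_iff_integrableOn_Ioc_of_le hb.le).1 hint)]
  · calc ∫⁻ t in Set.Ioi 0, P {w | t ≤ f w}
        ≤ ∫⁻ t in Set.Ioi 0, (Set.Ioc 0 b).indicator
            (fun t => ENNReal.ofReal (K * t ^ (-(1 / 2) : ℝ))) t := by
          refine setLIntegral_mono' measurableSet_Ioi fun t ht => ?_
          by_cases htb : t ≤ b
          · rw [Set.indicator_of_mem (show t ∈ Set.Ioc 0 b from ⟨ht, htb⟩)]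
            exact h t ht
          · have : {w | t ≤ f w} = ∅ := by
              ext w
              simpa using lt_of_le_of_lt (hfb w) (not_le.1 htb)
            simp [this]
      _ = _ := by
          rw [setLIntegral_indicator measurableSet_Ioc,
            Set.inter_eq_left.2 Set.Ioc_subset_Ioi_self]
  · refine (ae_restrict_mem measurableSet_Ioc).mono fun t ht => ?_
    exact mul_nonneg hK (Real.rpow_nonneg ht.1.le _)

theorem continuous_covMul (x : Fin N → Vec n) : Continuous (covMul x) := by
  have : covMul x = fun u => (N : ℝ)⁻¹ • ∑ i, (inner ℝ u (x i - mean x) : ℝ) • (x i - mean x) :=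
    funext (covMul_eq_sum x)
  rw [this]
  fun_prop

theorem measurable_preAct (x : Fin N → Vec n) (i : Fin N) : Measurable (preAct x i) := by
  have := continuous_covMul x
  have h1 : Measurable fun u : Vec n => (inner ℝ u (x i - mean x) : ℝ) := by fun_prop
  have h2 : Measurable fun u : Vec n => (inner ℝ u (covMul x u) : ℝ) :=
    (continuous_id.inner this).measurable
  exact h1.div h2.sqrt

/-- One data point suffices: `wᵀ V w ≥ ⟪w, x_i⟫ ^ 2 / N`, so a large inverse forces `w` close to the
hyperplane of `x_i`. Anti-concentration gives a tail of order `t ^ (-1/2)`, truncated at `1/σ_V`.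
The result grows only like `σ_V ^ (-1/2)`, better than the pointwise bound. -/
theorem DataAssumption.lintegral_inv_inner_covMul_le {B : ℝ} {x : Fin N → Vec n} {y : Fin N → ℝ}
    (h : DataAssumption B x y) :
    ∫⁻ w, ENNReal.ofReal ((inner ℝ (w : Vec n) (covMul x w))⁻¹) ∂(uniformGr1 n) ≤
      ENNReal.ofReal (4 * √(n * N / minEig (cov x))) := by
  have hs := h.minEig_pos
  have hN : (0 : ℝ) < N := by have := h.nonempty; positivity
  have hw : ∀ w : Gr1 n, ‖(w : Vec n)‖ = 1 := fun w => by simp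
  have hq := fun w : Gr1 n => h.inner_covMul_pos w (hw w)
  have hm : Measurable fun w : Gr1 n => (inner ℝ (w : Vec n) (covMul x w))⁻¹ := by
    have := continuous_covMul x
    have : Continuous fun w : Gr1 n => (inner ℝ (w : Vec n) (covMul x w) : ℝ) := by fun_prop
    exact this.measurable.inv
  refine (lintegral_le_of_meas_le_rpow (K := 2 * √(n * N)) (b := (minEig (cov x))⁻¹) hm
    (fun w => (inv_pos.2 (hq w)).le) (inv_pos.2 hs) (by positivity) ?_ ?_).trans_eq ?_
  · intro w
    have := minEig_cov_mul_le x w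
    rw [hw, one_pow, mul_one] at this
    gcongr
  · intro t ht
    have i0 : Fin N := ⟨0, h.nonempty⟩
    refine (measure_mono ?_).trans ((uniformGr1_abs_inner_le h.two_le_dim (x i0) (h.unit i0)
      (√(N / t)) (by positivity)).trans_eq ?_)
    · intro w htw
      simp only [Set.mem_ofPred_eq] at htw ⊢
      refine Real.abs_le_sqrt ?_
      rw [le_inv_comm₀ ht (hq w)] at htw
      have h1 : (N : ℝ) * inner ℝ (w : Vec n) (covMul x w) =
          ∑ i, (inner ℝ (w : Vec n) (x i) : ℝ) ^ 2 := by
        rw [inner_covMul_eq_sum, ← mul_assoc, mul_inv_cancel₀ hN.ne', one_mul, h.mean_zero]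
        simp [pow_two]
      have h2 := Finset.single_le_sum (f := fun i => (inner ℝ (w : Vec n) (x i) : ℝ) ^ 2)
        (fun i _ => sq_nonneg _) (Finset.mem_univ i0)
      rw [← h1] at h2
      rw [div_eq_mul_inv]
      exact h2.trans (by gcongr)
    · congr 1
      rw [Real.rpow_neg ht.le, ← Real.sqrt_eq_rpow, Real.sqrt_div hN.le, Real.sqrt_mul (by positivity)]
      field_simp
  · congr 1
    rw [Real.sqrt_div (by positivity), Real.sqrt_inv]
    field_simp
    ring

instance : IsProbabilityMeasure uniformSign := isProbabilityMeasure_uniformSign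

theorem ae_uniformSign : ∀ᵐ s ∂uniformSign, s = 1 ∨ s = -1 := by
  have hm : MeasurableSet {s : ℝ | s = 1 ∨ s = -1} :=
    (measurableSet_singleton 1).union (measurableSet_singleton (-1))
  rw [uniformSign, ae_add_measure_iff]
  constructor <;> refine Measure.ae_smul_measure ?_ _ <;> rw [ae_dirac_iff hm] <;> simp

theorem memLp_mul_uniformSign (b : ℝ) : MemLp (fun s : ℝ => s * b) 2 uniformSign := by
  refine MemLp.of_bound (by fun_prop) |b| ?_
  filter_upwards [ae_uniformSign] with s hs
  rcases hs with rfl | rfl <;> simp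

theorem integrable_dirac_real (f : ℝ → ℝ) (c : ℝ) : Integrable f (Measure.dirac c) :=
  integrable_dirac (by simp)

theorem integral_uniformSign (f : ℝ → ℝ) :
    ∫ s, f s ∂uniformSign = (f 1 + f (-1)) / 2 := by
  rw [uniformSign, integral_add_measure, integral_smul_measure, integral_smul_measure,
    integral_dirac, integral_dirac]
  · simp; ring
  · exact (integrable_dirac_real f 1).smul_measure (by simp)
  · exact (integrable_dirac_real f (-1)).smul_measure (by simp)

-- Independent centered signs have no cross terms, so the variances add.
open ProbabilityTheory in
theorem lintegral_sq_sum_uniformSign (b : Fin m → ℝ) :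
    ∫⁻ a, ENNReal.ofReal ((∑ j, a j * b j) ^ 2) ∂(Measure.pi fun _ : Fin m => uniformSign) =
      ENNReal.ofReal (∑ j, b j ^ 2) := by
  have hL : MemLp (fun a : Fin m → ℝ => ∑ j, a j * b j) 2
      (Measure.pi fun _ : Fin m => uniformSign) :=
    memLp_finsetSum _ fun j _ =>
      (memLp_mul_uniformSign (b j)).comp_measurePreserving (measurePreserving_eval _ j)
  have h0 : ∫ a, (∑ j, a j * b j) ∂(Measure.pi fun _ : Fin m => uniformSign) = 0 := by
    rw [integral_finsetSum]
    · refine Finset.sum_eq_zero fun j _ => ?_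
      rw [integral_comp_eval (μ := fun _ : Fin m => uniformSign) (i := j)
        (f := fun s : ℝ => s * b j) (by fun_prop), integral_uniformSign]
      simp
    · intro j _
      exact ((memLp_mul_uniformSign (b j)).comp_measurePreserving
        (measurePreserving_eval _ j)).integrable (by norm_num)
  have hv := variance_sum_pi (μ := fun _ : Fin m => uniformSign)
    (X := fun j s => s * b j) (fun j => memLp_mul_uniformSign (b j))
  have e : (∑ i, fun a : Fin m → ℝ => a i * b i) = fun a => ∑ j, a j * b j := by
    ext a; simp
  rw [e, variance_of_integral_eq_zero hL.aestronglyMeasurable.aemeasurable h0] at hv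
  rw [← ofReal_integral_eq_lintegral_ofReal hL.integrable_sq
    (Filter.Eventually.of_forall fun a => sq_nonneg _)]
  congr 1
  refine hv.trans (Finset.sum_congr rfl fun j _ => ?_)
  rw [variance_of_integral_eq_zero (by fun_prop)]
  · rw [integral_uniformSign]; simp
  · rw [integral_uniformSign]; simp

/-- Batch normalization makes the squared pre-activations sum to exactly `N`, and the ReLU only
decreases squares. -/
theorem DataAssumption.sum_relu_preAct_sq_le {B : ℝ} {x : Fin N → Vec n} {y : Fin N → ℝ}
    (h : DataAssumption B x y) (u : Vec n) (hu : ‖u‖ = 1) :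
    ∑ i, relu (preAct x i u) ^ 2 ≤ N := by
  have hN : (0 : ℝ) < N := by have := h.nonempty; positivity
  have hq := h.inner_covMul_pos u hu
  have h1 : ∀ i, relu (preAct x i u) ^ 2 ≤
      (inner ℝ u (x i - mean x) * inner ℝ u (x i - mean x)) / inner ℝ u (covMul x u) := by
    intro i
    have h2 : preAct x i u ^ 2 = (inner ℝ u (x i - mean x) * inner ℝ u (x i - mean x)) /
        inner ℝ u (covMul x u) := by
      rw [preAct, div_pow, stdDev, Real.sq_sqrt hq.le, pow_two]
    rw [← h2, relu]
    rcases le_total (preAct x i u) 0 with h3 | h3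
    · rw [max_eq_right h3]; rw [zero_pow two_ne_zero]; positivity
    · rw [max_eq_left h3]
  refine (Finset.sum_le_sum fun i _ => h1 i).trans_eq ?_
  rw [← Finset.sum_div, div_eq_iff hq.ne', inner_covMul_eq_sum, ← mul_assoc,
    mul_inv_cancel₀ hN.ne', one_mul]

theorem vecNorm_sq {ι : Type*} [Fintype ι] (v : ι → ℝ) : vecNorm v ^ 2 = ∑ i, v i ^ 2 :=
  Real.sq_sqrt (by positivity)

theorem measurable_output (x : Fin N → Vec n) (i : Fin N) :
    Measurable fun ω : (Fin m → Gr1 n) × (Fin m → ℝ) =>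
      output x ω.2 (fun j => (ω.1 j : Vec n)) i := by
  have := measurable_preAct x i
  have h2 : Measurable relu := by unfold relu; fun_prop
  unfold output
  refine Measurable.const_mul (Finset.measurable_sum _ fun j _ => ?_) _
  refine Measurable.mul (by fun_prop) (h2.comp (this.comp ?_))
  fun_prop

theorem measurable_residual (x : Fin N → Vec n) (y : Fin N → ℝ) :
    Measurable fun ω : (Fin m → Gr1 n) × (Fin m → ℝ) =>
      residual x y ω.2 (fun j => (ω.1 j : Vec n)) := by
  have := fun i => measurable_output (m := m) x i
  unfold residual vecNorm
  refine Measurable.sqrt (Finset.measurable_sum _ fun i _ => ?_)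
  exact ((this i).sub_const _).pow_const 2

theorem DataAssumption.isProbabilityMeasure {B : ℝ} {x : Fin N → Vec n} {y : Fin N → ℝ}
    (h : DataAssumption B x y) : IsProbabilityMeasure (uniformGr1 n) :=
  isProbabilityMeasure_uniformGr1 (by have := h.two_le_dim; omega)

theorem DataAssumption.lintegral_sum_output_sq_le {B : ℝ} {x : Fin N → Vec n} {y : Fin N → ℝ}
    (h : DataAssumption B x y) (θ : Fin m → Vec n) (hθ : ∀ j, ‖θ j‖ = 1) :
    ∫⁻ a, ENNReal.ofReal (∑ i, output x a θ i ^ 2) ∂(Measure.pi fun _ : Fin m => uniformSign) ≤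
      ENNReal.ofReal N := by
  have h1 : ∀ (a : Fin m → ℝ) i, output x a θ i ^ 2 =
      (∑ j, a j * ((√(m : ℝ))⁻¹ * relu (preAct x i (θ j)))) ^ 2 := by
    intro a i
    rw [output, Finset.mul_sum]
    congr 1
    exact Finset.sum_congr rfl fun j _ => by ring
  simp only [h1]
  simp_rw [ENNReal.ofReal_sum_of_nonneg fun i _ => sq_nonneg _]
  rw [lintegral_finsetSum _ fun i _ => by fun_prop]
  simp_rw [lintegral_sq_sum_uniformSign]
  rw [← ENNReal.ofReal_sum_of_nonneg fun i _ => by positivity]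
  refine ENNReal.ofReal_le_ofReal ?_
  rw [Finset.sum_comm]
  have h2 : ∀ j, ∑ i, ((√(m : ℝ))⁻¹ * relu (preAct x i (θ j))) ^ 2 ≤ (m : ℝ)⁻¹ * N := by
    intro j
    simp only [mul_pow, ← Finset.mul_sum, inv_pow, Real.sq_sqrt (Nat.cast_nonneg m)]
    exact mul_le_mul_of_nonneg_left (h.sum_relu_preAct_sq_le _ (hθ j)) (by positivity)
  refine (Finset.sum_le_sum fun j _ => h2 j).trans ?_
  simp only [Finset.sum_const, Finset.card_univ, Fintype.card_fin, nsmul_eq_mul]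
  rcases Nat.eq_zero_or_pos m with rfl | hm
  · simp
  · rw [← mul_assoc, mul_inv_cancel₀ (by positivity), one_mul]

theorem DataAssumption.lintegral_residual_sq_le {B : ℝ} {x : Fin N → Vec n} {y : Fin N → ℝ}
    (h : DataAssumption B x y) :
    ∫⁻ ω, ENNReal.ofReal (residual x y ω.2 (fun j => (ω.1 j : Vec n)) ^ 2) ∂(initLaw n m) ≤
      ENNReal.ofReal (2 * (1 + B ^ 2) * N) := by
  have := h.isProbabilityMeasure
  have hmr := measurable_residual (m := m) x y
  rw [initLaw, lintegral_prod _ ((hmr.pow_const 2).ennreal_ofReal.aemeasurable)]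
  have hb : ∀ θ : Fin m → Gr1 n, ∫⁻ a, ENNReal.ofReal
      (residual x y a (fun j => (θ j : Vec n)) ^ 2) ∂(Measure.pi fun _ : Fin m => uniformSign) ≤
        ENNReal.ofReal (2 * (1 + B ^ 2) * N) := by
    intro θ
    have h1 : ∀ a, residual x y a (fun j => (θ j : Vec n)) ^ 2 ≤
        2 * (∑ i, output x a (fun j => (θ j : Vec n)) i ^ 2) + 2 * B ^ 2 * N := by
      intro a
      rw [residual, vecNorm_sq]
      have h2 : ∀ i, (output x a (fun j => (θ j : Vec n)) - y) i ^ 2 ≤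
          2 * output x a (fun j => (θ j : Vec n)) i ^ 2 + 2 * B ^ 2 := by
        intro i
        have h3 : y i ^ 2 ≤ B ^ 2 := sq_le_sq' (by linarith [(abs_le.1 (h.bounded i)).1])
          (abs_le.1 (h.bounded i)).2
        simp only [Pi.sub_apply]
        nlinarith [sq_nonneg (output x a (fun j => (θ j : Vec n)) i + y i)]
      refine (Finset.sum_le_sum fun i _ => h2 i).trans_eq ?_
      rw [Finset.sum_add_distrib, ← Finset.mul_sum]
      simp
      ring
    have hm : Measurable fun a : Fin m → ℝ =>
        ∑ i, output x a (fun j => (θ j : Vec n)) i ^ 2 := by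
      refine Finset.measurable_sum _ fun i _ => ?_
      exact ((measurable_output x i).comp measurable_prodMk_left).pow_const 2
    calc _ ≤ ∫⁻ a, (ENNReal.ofReal 2 * ENNReal.ofReal (∑ i, output x a (fun j => (θ j : Vec n)) i ^ 2)
            + ENNReal.ofReal (2 * B ^ 2 * N)) ∂(Measure.pi fun _ : Fin m => uniformSign) := by
          refine lintegral_mono fun a => ?_
          rw [← ENNReal.ofReal_mul (by norm_num), ← ENNReal.ofReal_add (by positivity) (by positivity)]
          exact ENNReal.ofReal_le_ofReal (h1 a)
      _ ≤ ENNReal.ofReal 2 * ENNReal.ofReal N + ENNReal.ofReal (2 * B ^ 2 * N) := by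
          rw [lintegral_add_right _ (by fun_prop), lintegral_const_mul _ (by fun_prop)]
          simp only [lintegral_const, measure_univ, mul_one]
          gcongr
          exact h.lintegral_sum_output_sq_le _ fun j => by simp
      _ = _ := by
          rw [← ENNReal.ofReal_mul (by norm_num), ← ENNReal.ofReal_add (by positivity) (by positivity)]
          congr 1
          ring
  refine (lintegral_mono hb).trans ?_
  simp

/-! ### Probability -/

theorem measure_compl_le_of_lintegral_le {Ω : Type*} [MeasurableSpace Ω] {P : Measure Ω} {f : Ω → ℝ}
    {K ε : ℝ} (hf : Measurable f) (hK : 0 < K) (hε : 0 < ε)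
    (h : ∫⁻ w, ENNReal.ofReal (f w) ∂P ≤ ENNReal.ofReal K) :
    P {w | f w ≤ K / ε}ᶜ ≤ ENNReal.ofReal ε := by
  have h1 := mul_meas_ge_le_lintegral (μ := P) hf.ennreal_ofReal (ENNReal.ofReal (K / ε))
  have h2 : {w | f w ≤ K / ε}ᶜ ⊆ {w | ENNReal.ofReal (K / ε) ≤ ENNReal.ofReal (f w)} := by
    intro w hw
    simp only [Set.mem_compl_iff, Set.mem_ofPred_eq, not_le] at hw
    exact ENNReal.ofReal_le_ofReal hw.le
  have h3 : ENNReal.ofReal (K / ε) * P {w | f w ≤ K / ε}ᶜ ≤ ENNReal.ofReal K :=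
    ((mul_le_mul_right (measure_mono h2) _).trans h1).trans h
  have h4 : ENNReal.ofReal K = ENNReal.ofReal (K / ε) * ENNReal.ofReal ε := by
    rw [← ENNReal.ofReal_mul (by positivity)]
    congr 1
    field_simp
  rw [h4] at h3
  exact (ENNReal.mul_le_mul_iff_right (by simpa using by positivity) ENNReal.ofReal_ne_top).1 h3

theorem measure_compl_inter_le {Ω : Type*} [MeasurableSpace Ω] {P : Measure Ω} {s t : Set Ω}
    {ε₁ ε₂ : ℝ} (h₁ : 0 ≤ ε₁) (h₂ : 0 ≤ ε₂) (hs : P sᶜ ≤ ENNReal.ofReal ε₁)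
    (ht : P tᶜ ≤ ENNReal.ofReal ε₂) : P (s ∩ t)ᶜ ≤ ENNReal.ofReal (ε₁ + ε₂) := by
  rw [Set.compl_inter, ENNReal.ofReal_add h₁ h₂]
  exact (measure_union_le _ _).trans (add_le_add hs ht)

theorem ofReal_one_sub_le_measure {Ω : Type*} [MeasurableSpace Ω] {P : Measure Ω}
    [IsProbabilityMeasure P] {s : Set Ω} {ε : ℝ} (hε : 0 ≤ ε) (hm : MeasurableSet s)
    (hs : P sᶜ ≤ ENNReal.ofReal ε) : ENNReal.ofReal (1 - ε) ≤ P s := by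
  rw [ENNReal.ofReal_sub _ hε, ENNReal.ofReal_one, tsub_le_iff_right, ← prob_add_prob_compl (μ := P) hm]
  gcongr

theorem lintegral_initLaw_fst [IsProbabilityMeasure (uniformGr1 n)] {f : (Fin m → Gr1 n) → ENNReal}
    (hf : Measurable f) :
    ∫⁻ ω, f ω.1 ∂(initLaw n m) = ∫⁻ θ, f θ ∂(Measure.pi fun _ : Fin m => uniformGr1 n) :=
  measurePreserving_fst.lintegral_comp hf

theorem lintegral_pi_eval [IsProbabilityMeasure (uniformGr1 n)] {f : Gr1 n → ENNReal}
    (hf : Measurable f) (j : Fin m) :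
    ∫⁻ θ, f (θ j) ∂(Measure.pi fun _ : Fin m => uniformGr1 n) = ∫⁻ w, f w ∂(uniformGr1 n) :=
  (measurePreserving_eval (fun _ : Fin m => uniformGr1 n) j).lintegral_comp hf

theorem lintegral_average_le [IsProbabilityMeasure (uniformGr1 n)] {f : Gr1 n → ℝ}
    (hf : Measurable f) (hf0 : ∀ w, 0 ≤ f w) {K : ℝ} (hK : 0 ≤ K)
    (h : ∫⁻ w, ENNReal.ofReal (f w) ∂(uniformGr1 n) ≤ ENNReal.ofReal K) :
    ∫⁻ ω, ENNReal.ofReal ((m : ℝ)⁻¹ * ∑ j, f (ω.1 j)) ∂(initLaw n m) ≤ ENNReal.ofReal K := by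
  rw [lintegral_initLaw_fst (f := fun θ => ENNReal.ofReal ((m : ℝ)⁻¹ * ∑ j, f (θ j))) (by fun_prop)]
  simp_rw [ENNReal.ofReal_mul (show (0 : ℝ) ≤ (m : ℝ)⁻¹ by positivity),
    ENNReal.ofReal_sum_of_nonneg fun j _ => hf0 _]
  rw [lintegral_const_mul _ (by fun_prop), lintegral_finsetSum _ fun j _ => by fun_prop]
  simp_rw [lintegral_pi_eval (f := fun w => ENNReal.ofReal (f w)) (by fun_prop)]
  refine (mul_le_mul_right (Finset.sum_le_sum fun j _ => h) _).trans ?_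
  rw [Finset.sum_const, Finset.card_univ, Fintype.card_fin, nsmul_eq_mul,
    ← ENNReal.ofReal_natCast, ← ENNReal.ofReal_mul (by positivity),
    ← ENNReal.ofReal_mul (by positivity), ← mul_assoc]
  refine ENNReal.ofReal_le_ofReal ?_
  rcases Nat.eq_zero_or_pos m with rfl | hm
  · simpa using hK
  · rw [inv_mul_cancel₀ (by positivity), one_mul]

theorem measurableSet_sign :
    MeasurableSet {ω : (Fin m → Gr1 n) × (Fin m → ℝ) | ∀ j, ω.2 j = 1 ∨ ω.2 j = -1} := by
  have : {ω : (Fin m → Gr1 n) × (Fin m → ℝ) | ∀ j, ω.2 j = 1 ∨ ω.2 j = -1} =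
      ⋂ j, (fun ω => ω.2 j) ⁻¹' {1, -1} := by
    ext ω; simp
  rw [this]
  exact MeasurableSet.iInter fun j => (by fun_prop : Measurable _) (by measurability)

theorem measure_sign_compl [IsProbabilityMeasure (uniformGr1 n)] :
    initLaw n m {ω | ∀ j, ω.2 j = 1 ∨ ω.2 j = -1}ᶜ = 0 := by
  change ∀ᵐ ω ∂(initLaw n m), ∀ j, ω.2 j = 1 ∨ ω.2 j = -1
  rw [ae_all_iff]
  intro j
  have hq : Measure.QuasiMeasurePreserving
      (fun ω : (Fin m → Gr1 n) × (Fin m → ℝ) => ω.2 j) (initLaw n m) uniformSign :=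
    ((measurePreserving_eval (fun _ : Fin m => uniformSign) j).comp
      (measurePreserving_snd (μ := Measure.pi fun _ : Fin m => uniformGr1 n))).quasiMeasurePreserving
  exact hq.ae ae_uniformSign

/-! ### Variation of the Jacobian -/

open Classical in
/-- The number of pairs `(i, j)` for which `|θ_jᵀ x_i| ≤ δ`. -/
noncomputable def nearKink (x : Fin N → Vec n) (δ : ℝ) (θ : Fin m → Vec n) : ℝ :=
  ∑ j, ∑ i, if |inner ℝ (θ j) (x i)| ≤ δ then 1 else 0

theorem weightDist_sq (θ θ' : Fin m → Vec n) : weightDist θ θ' ^ 2 = ∑ j, ‖θ j - θ' j‖ ^ 2 :=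
  Real.sq_sqrt (by positivity)

theorem frobNorm_sq {ι κ : Type*} [Fintype ι] [Fintype κ] (A : Matrix ι κ ℝ) :
    frobNorm A ^ 2 = ∑ i, ∑ k, A i k ^ 2 := Real.sq_sqrt (by positivity)

theorem frobNorm_jacobian_sub_sq (x : Fin N → Vec n) {a : Fin m → ℝ}
    (ha : ∀ j, a j = 1 ∨ a j = -1) (θ θ₀ : Fin m → Vec n) :
    frobNorm (jacobian x a θ - jacobian x a θ₀) ^ 2 = (m : ℝ)⁻¹ * ∑ j, ∑ i,
      ‖(if 0 ≤ inner ℝ (θ j) (x i - mean x) then (1 : ℝ) else 0) • preActGrad x i (θ j) -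
        (if 0 ≤ inner ℝ (θ₀ j) (x i - mean x) then (1 : ℝ) else 0) • preActGrad x i (θ₀ j)‖ ^ 2 := by
  rw [frobNorm_sq, Finset.sum_comm, Fintype.sum_prod_type, Finset.mul_sum]
  refine Finset.sum_congr rfl fun j _ => ?_
  rw [Finset.sum_comm, Finset.mul_sum]
  refine Finset.sum_congr rfl fun i _ => ?_
  rw [EuclideanSpace.norm_sq_eq, Finset.mul_sum]
  refine Finset.sum_congr rfl fun l _ => ?_
  simp only [jacobian, Matrix.sub_apply, Matrix.of_apply, PiLp.sub_apply, PiLp.smul_apply,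
    smul_eq_mul, Real.norm_eq_abs, sq_abs]
  simp only [mul_assoc]
  rw [← mul_sub, ← mul_sub, mul_pow, mul_pow, sign_sq (ha j), inv_pow,
    Real.sq_sqrt (Nat.cast_nonneg m), one_mul]

/-- If the two indicators agree, the Lipschitz bound applies. If they differ, `⟪·, x⟫` changed sign,
so `|⟪w₀, x⟫| ≤ ‖w - w₀‖`: either `w₀` is within δ of the hyperplane, or the displacement exceeds δ
and the last ratio is at least 1. Both cases absorb the trivial bound `M`. -/
theorem norm_indicator_smul_sub_sq_le {E : Type*} [NormedAddCommGroup E] [InnerProductSpace ℝ E]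
    {w w₀ x φ φ₀ : E} {L M δ : ℝ} (hx : ‖x‖ = 1) (hL : ‖φ - φ₀‖ ≤ L * ‖w - w₀‖)
    (hM : ‖φ‖ ^ 2 ≤ M) (hM₀ : ‖φ₀‖ ^ 2 ≤ M) (hδ : 0 < δ) :
    ‖(if 0 ≤ inner ℝ w x then (1 : ℝ) else 0) • φ -
        (if 0 ≤ inner ℝ w₀ x then (1 : ℝ) else 0) • φ₀‖ ^ 2 ≤
      L ^ 2 * ‖w - w₀‖ ^ 2 + M * (if |inner ℝ w₀ x| ≤ δ then 1 else 0) +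
        M * (‖w - w₀‖ ^ 2 / δ ^ 2) := by
  have hM' : 0 ≤ M := (sq_nonneg _).trans hM
  have hLL : 0 ≤ L ^ 2 * ‖w - w₀‖ ^ 2 := by positivity
  have hq : 0 ≤ M * (‖w - w₀‖ ^ 2 / δ ^ 2) := by positivity
  have hi : 0 ≤ M * (if |inner ℝ w₀ x| ≤ δ then 1 else 0) := by positivity
  have key : |inner ℝ w₀ x| ≤ ‖w - w₀‖ →
      M ≤ M * (if |inner ℝ w₀ x| ≤ δ then 1 else 0) + M * (‖w - w₀‖ ^ 2 / δ ^ 2) := by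
    intro hk
    by_cases hd : |inner ℝ w₀ x| ≤ δ
    · rw [if_pos hd]; linarith
    · rw [if_neg hd]
      have h1 : δ ≤ ‖w - w₀‖ := (not_le.1 hd).le.trans hk
      have h2 : 1 ≤ ‖w - w₀‖ ^ 2 / δ ^ 2 := by
        rw [one_le_div (by positivity)]; gcongr
      nlinarith
  have hsub : |(inner ℝ w x : ℝ) - inner ℝ w₀ x| ≤ ‖w - w₀‖ := by
    rw [← inner_sub_left]
    simpa [hx] using abs_real_inner_le_norm (w - w₀) x
  rw [abs_le] at hsub
  by_cases h1 : 0 ≤ (inner ℝ w x : ℝ) <;> by_cases h2 : 0 ≤ (inner ℝ w₀ x : ℝ)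
  · rw [if_pos h1, if_pos h2, one_smul, one_smul]
    have : ‖φ - φ₀‖ ^ 2 ≤ (L * ‖w - w₀‖) ^ 2 := by gcongr
    rw [mul_pow] at this
    linarith
  · rw [if_pos h1, if_neg h2, one_smul, zero_smul, sub_zero]
    have := key (by rw [abs_of_neg (not_le.1 h2)]; linarith)
    linarith
  · rw [if_neg h1, if_pos h2, one_smul, zero_smul, zero_sub, norm_neg]
    have := key (by rw [abs_of_nonneg h2]; linarith [not_le.1 h1])
    linarith
  · rw [if_neg h1, if_neg h2, zero_smul, zero_smul, sub_zero, norm_zero]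
    have : (0 : ℝ) ^ 2 = 0 := by norm_num
    linarith

theorem DataAssumption.frobNorm_jacobian_sub_sq_le {B L δ : ℝ} {x : Fin N → Vec n} {y : Fin N → ℝ}
    (h : DataAssumption B x y)
    (hLip : ∀ (i : Fin N) (u v : Gr1 n),
      ‖preActGrad x i u - preActGrad x i v‖ ≤ L * ‖(u : Vec n) - v‖)
    (hδ : 0 < δ) {a : Fin m → ℝ} (ha : ∀ j, a j = 1 ∨ a j = -1) {θ θ₀ : Fin m → Vec n}
    (hθ : ∀ j, ‖θ j‖ = 1) (hθ₀ : ∀ j, ‖θ₀ j‖ = 1) :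
    frobNorm (jacobian x a θ - jacobian x a θ₀) ^ 2 ≤
      (m : ℝ)⁻¹ * (N * L ^ 2 * weightDist θ θ₀ ^ 2 + gradBound x * nearKink x δ θ₀ +
        N * gradBound x * (weightDist θ θ₀ ^ 2 / δ ^ 2)) := by
  rw [frobNorm_jacobian_sub_sq x ha]
  refine mul_le_mul_of_nonneg_left ?_ (by positivity)
  rw [nearKink, weightDist_sq, h.mean_zero, Finset.sum_div, Finset.mul_sum, Finset.mul_sum,
    Finset.mul_sum, ← Finset.sum_add_distrib, ← Finset.sum_add_distrib]
  refine Finset.sum_le_sum fun j _ => ?_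
  have h1 : ∀ i, ‖preActGrad x i (θ j) - preActGrad x i (θ₀ j)‖ ≤ L * ‖θ j - θ₀ j‖ := fun i =>
    hLip i ⟨θ j, by simpa using hθ j⟩ ⟨θ₀ j, by simpa using hθ₀ j⟩
  simp only [sub_zero]
  refine (Finset.sum_le_sum fun i _ => norm_indicator_smul_sub_sq_le (h.unit i) (h1 i)
    (h.norm_preActGrad_sq_le i _ (hθ j)) (h.norm_preActGrad_sq_le i _ (hθ₀ j)) hδ).trans_eq ?_
  simp only [Finset.sum_add_distrib, Finset.sum_const, Finset.card_univ,
    Fintype.card_fin, nsmul_eq_mul, ← Finset.mul_sum]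
  congr 1
  · congr 1
    ring
  · ring

theorem DataAssumption.lintegral_nearKink_le {B : ℝ} {x : Fin N → Vec n} {y : Fin N → ℝ}
    (h : DataAssumption B x y) {δ : ℝ} (hδ : 0 < δ) :
    (Measurable fun ω : (Fin m → Gr1 n) × (Fin m → ℝ) =>
      (m : ℝ)⁻¹ * nearKink x δ fun j => (ω.1 j : Vec n)) ∧
    ∫⁻ ω, ENNReal.ofReal ((m : ℝ)⁻¹ * nearKink x δ fun j => (ω.1 j : Vec n)) ∂(initLaw n m) ≤
      ENNReal.ofReal (N * (2 * √(n : ℝ) * δ)) := by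
  classical
  have := h.isProbabilityMeasure
  have hms : ∀ i, MeasurableSet {w : Gr1 n | |inner ℝ (w : Vec n) (x i)| ≤ δ} := fun i =>
    measurableSet_le (by fun_prop) (by fun_prop)
  have hm : ∀ i, Measurable fun w : Gr1 n =>
      if |inner ℝ (w : Vec n) (x i)| ≤ δ then (1 : ℝ) else 0 := fun i =>
    Measurable.ite (hms i) measurable_const measurable_const
  obtain ⟨g, hg⟩ : ∃ g : Gr1 n → ℝ,
      g = fun w : Gr1 n => ∑ i, if |inner ℝ (w : Vec n) (x i)| ≤ δ then (1 : ℝ) else 0 := ⟨_, rfl⟩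
  have e : ∀ θ : Fin m → Gr1 n, nearKink x δ (fun j => (θ j : Vec n)) = ∑ j, g (θ j) := by
    intro θ
    rw [hg]
    exact Finset.sum_congr rfl fun j _ => Finset.sum_congr rfl fun i _ => by congr
  have hm' : Measurable g := hg ▸ Finset.measurable_sum _ fun i _ => hm i
  simp_rw [e]
  refine ⟨by fun_prop, lintegral_average_le hm' (fun w => by rw [hg]; positivity)
    (by positivity) ?_⟩
  rw [hg]
  have h0 : ∀ w : Gr1 n,
      ENNReal.ofReal (∑ i, if |inner ℝ (w : Vec n) (x i)| ≤ δ then (1 : ℝ) else 0) =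
        ∑ i, ENNReal.ofReal (if |inner ℝ (w : Vec n) (x i)| ≤ δ then (1 : ℝ) else 0) := fun w =>
    ENNReal.ofReal_sum_of_nonneg fun i _ => by positivity
  simp only [h0]
  rw [lintegral_finsetSum _ fun i _ => (hm i).ennreal_ofReal]
  have h1 : ∀ i, ∫⁻ w : Gr1 n, ENNReal.ofReal
      (if |inner ℝ (w : Vec n) (x i)| ≤ δ then (1 : ℝ) else 0) ∂(uniformGr1 n) ≤
        ENNReal.ofReal (2 * √(n : ℝ) * δ) := by
    intro i
    have h2 : (fun w : Gr1 n => ENNReal.ofReal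
        (if |inner ℝ (w : Vec n) (x i)| ≤ δ then (1 : ℝ) else 0)) =
        {w : Gr1 n | |inner ℝ (w : Vec n) (x i)| ≤ δ}.indicator 1 := by
      ext w
      by_cases hw : |inner ℝ (w : Vec n) (x i)| ≤ δ
      · rw [Set.indicator_of_mem (by exact hw), if_pos hw]; simp
      · rw [Set.indicator_of_notMem (by exact hw), if_neg hw]; simp
    rw [h2, lintegral_indicator_one (hms i)]
    exact uniformGr1_abs_inner_le h.two_le_dim (x i) (h.unit i) δ hδ.le
  refine (Finset.sum_le_sum fun i _ => h1 i).trans_eq ?_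
  rw [Finset.sum_const, Finset.card_univ, Fintype.card_fin, nsmul_eq_mul,
    ← ENNReal.ofReal_natCast, ← ENNReal.ofReal_mul (by positivity)]

/-- The three contributions to the variation of the Jacobian are bounded by `(16/25) τ²`. -/
theorem variation_terms_le {τ ε L M A s n N m D κ S : ℝ} (hτ : 0 < τ) (hε : 0 < ε) (hL : 0 ≤ L)
    (hM : 0 < M) (hA : A = L + 2 * M) (hs : 0 < s) (hsM : s⁻¹ ≤ 2 * M) (hn : 2 ≤ n) (hN : 3 ≤ N)
    (hm : 0 < m) (hD0 : 0 ≤ D) (hD : D * (A ^ 3 * Real.pi * n * N ^ 5) ≤ m * τ ^ 6 * ε ^ 2)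
    (hτS : 36 * τ ^ 2 ≤ S) (hS : S ≤ 4 * √(n * N / s) / (ε / 5))
    (hκ : m⁻¹ * κ ≤ N * (2 * √n * (4 / 25 * τ ^ 2 * ε / (M * N * √n))) / (4 * ε / 5)) :
    m⁻¹ * (N * L ^ 2 * D + M * κ + N * M * (D / (4 / 25 * τ ^ 2 * ε / (M * N * √n)) ^ 2)) ≤
      (4 / 5 * τ) ^ 2 := by
  have hπ := Real.pi_gt_three
  have hA2 : 2 * M ≤ A := by linarith
  have hLA : L ≤ A := by linarith
  have hA0 : 0 < A := by linarith
  have hn0 : 0 < n := by linarith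
  have hN0 : 0 < N := by linarith
  have hsn : 0 < √n := Real.sqrt_pos.2 hn0
  have hsn2 : √n ^ 2 = n := Real.sq_sqrt hn0.le
  have hDm : D / m ≤ τ ^ 6 * ε ^ 2 / (A ^ 3 * Real.pi * n * N ^ 5) := by
    rw [div_le_div_iff₀ hm (by positivity)]
    linarith
  have hDm0 : 0 ≤ D / m := by positivity
  have hsA : 1 ≤ s * A := by
    have h1 : s⁻¹ ≤ A := by linarith
    rw [inv_le_iff_one_le_mul₀ hs] at h1
    linarith
  -- The Markov bound on the mean inverse variance serves only to bound the scale from above, which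
  -- makes the Lipschitz contribution, of order `τ ^ 6`, comparable to `τ ^ 2`.
  have hτε : (τ ^ 2 * ε) ^ 2 ≤ 25 / 81 * (n * N / s) := by
    have h1 : 9 * (τ ^ 2 * ε) ≤ 5 * √(n * N / s) := by
      have h2 := hτS.trans hS
      rw [le_div_iff₀ (by positivity)] at h2
      linarith
    have h3 : (9 * (τ ^ 2 * ε)) ^ 2 ≤ (5 * √(n * N / s)) ^ 2 := by gcongr
    rw [mul_pow 9, mul_pow 5, Real.sq_sqrt (by positivity)] at h3
    linarith
  -- The budget is `1/100 + 2/5 + 1/5 = 0.61 ≤ 16/25`. Here `s * A ≥ 1`, from `1/s ≤ 2M ≤ A`,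
  -- removes the dependence on the smallest eigenvalue.
  have t1 : N * L ^ 2 * (D / m) ≤ 1 / 100 * τ ^ 2 := by
    calc N * L ^ 2 * (D / m) ≤ N * A ^ 2 * (τ ^ 6 * ε ^ 2 / (A ^ 3 * Real.pi * n * N ^ 5)) := by
          gcongr
      _ = τ ^ 2 * ((τ ^ 2 * ε) ^ 2 / (A * Real.pi * n * N ^ 4)) := by field_simp
      _ ≤ τ ^ 2 * ((25 / 81 * (n * N / s)) / (A * Real.pi * n * N ^ 4)) := by gcongr
      _ = τ ^ 2 * ((25 / 81) / (s * A * Real.pi * N ^ 3)) := by field_simp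
      _ ≤ τ ^ 2 * ((25 / 81) / (1 * 3 * 3 ^ 3)) := by gcongr
      _ ≤ 1 / 100 * τ ^ 2 := by nlinarith [sq_nonneg τ]
  have t2 : M * (m⁻¹ * κ) ≤ 2 / 5 * τ ^ 2 := by
    refine (mul_le_mul_of_nonneg_left hκ hM.le).trans_eq ?_
    field_simp
    norm_num
  have t3 : N * M * ((D / m) / (4 / 25 * τ ^ 2 * ε / (M * N * √n)) ^ 2) ≤ 1 / 5 * τ ^ 2 := by
    calc _ ≤ N * M * ((τ ^ 6 * ε ^ 2 / (A ^ 3 * Real.pi * n * N ^ 5)) /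
            (4 / 25 * τ ^ 2 * ε / (M * N * √n)) ^ 2) := by gcongr
      _ = 625 / 16 * τ ^ 2 * (M ^ 3 / (A ^ 3 * Real.pi * N ^ 2)) := by
          rw [div_pow, mul_pow (M * N), hsn2]
          field_simp
          norm_num
      _ ≤ 625 / 16 * τ ^ 2 * (M ^ 3 / ((2 * M) ^ 3 * 3 * 3 ^ 2)) := by gcongr
      _ = 625 / 16 / 216 * τ ^ 2 := by field_simp; norm_num
      _ ≤ 1 / 5 * τ ^ 2 := by nlinarith [sq_nonneg τ]
  have e : m⁻¹ * (N * L ^ 2 * D + M * κ + N * M * (D / (4 / 25 * τ ^ 2 * ε / (M * N * √n)) ^ 2)) =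
      N * L ^ 2 * (D / m) + M * (m⁻¹ * κ) +
        N * M * ((D / m) / (4 / 25 * τ ^ 2 * ε / (M * N * √n)) ^ 2) := by
    field_simp
  rw [e]
  nlinarith [sq_nonneg τ]

theorem weightDist_nonneg (θ θ' : Fin m → Vec n) : 0 ≤ weightDist θ θ' := Real.sqrt_nonneg _

/-- Uniform control, with high probability, of the variation of the Jacobian around the
initialization, at a deterministic scale `τ`. -/
theorem DataAssumption.exists_event_frobNorm_jacobian_sub_le {B L τ ε : ℝ} {x : Fin N → Vec n}
    {y : Fin N → ℝ} (h : DataAssumption B x y)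
    (hLip : ∀ (i : Fin N) (u v : Gr1 n),
      ‖preActGrad x i u - preActGrad x i v‖ ≤ L * ‖(u : Vec n) - v‖)
    (hL : 0 < L) (hτ : 0 < τ) (hε : 0 < ε) :
    ∃ G : Set ((Fin m → Gr1 n) × (Fin m → ℝ)), MeasurableSet G ∧
      initLaw n m Gᶜ ≤ ENNReal.ofReal ε ∧
      ∀ ω ∈ G, (∀ j, ω.2 j = 1 ∨ ω.2 j = -1) ∧
        (6 * τ ≤ sigma0 x ω.2 (fun j => (ω.1 j : Vec n)) →
          ∀ θ : Fin m → Vec n, (∀ j, ‖θ j‖ = 1) →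
            weightDist θ (fun j => (ω.1 j : Vec n)) ^ 2 *
              ((L + 2 * gradBound x) ^ 3 * Real.pi * n * N ^ 5) ≤ m * τ ^ 6 * ε ^ 2 →
            frobNorm (jacobian x ω.2 θ - jacobian x ω.2 (fun j => (ω.1 j : Vec n))) ≤
              4 / 5 * τ) := by
  have := h.isProbabilityMeasure
  have hn2 : (2 : ℝ) ≤ n := by exact_mod_cast h.two_le_dim
  have hN3 : (3 : ℝ) ≤ N := by exact_mod_cast h.three_le_card
  have hn0 : (0 : ℝ) < n := by linarith
  have hN0 : (0 : ℝ) < N := by linarith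
  have hs := h.minEig_pos
  have hsM := h.inv_minEig_le
  have hM : 0 < gradBound x := by
    have := inv_pos.2 hs
    linarith
  -- Chosen so that the expected number of near-kink pairs, after Markov at level `4ε/5`,
  -- contributes exactly `2/5 * τ ^ 2`. The cubed `L + 2 * gradBound x` in the width is then what
  -- pays for `M / δ ^ 2`.
  set δ : ℝ := 4 / 25 * τ ^ 2 * ε / (gradBound x * N * √(n : ℝ)) with hδ_def
  have hsn : 0 < √(n : ℝ) := Real.sqrt_pos.2 hn0
  have hδ : 0 < δ := by positivity
  obtain ⟨hk_meas, hk⟩ := h.lintegral_nearKink_le (m := m) hδ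
  have hQ0 : ∀ w : Gr1 n, 0 ≤ (inner ℝ (w : Vec n) (covMul x w))⁻¹ := fun w =>
    (inv_pos.2 (h.inner_covMul_pos w (by simp))).le
  have hQ_meas : Measurable fun w : Gr1 n => (inner ℝ (w : Vec n) (covMul x w))⁻¹ := by
    have := continuous_covMul x
    have : Continuous fun w : Gr1 n => (inner ℝ (w : Vec n) (covMul x w) : ℝ) := by fun_prop
    exact this.measurable.inv
  have hQ := lintegral_average_le (m := m) hQ_meas hQ0 (by positivity)
    h.lintegral_inv_inner_covMul_le
  have hQm_meas : Measurable fun ω : (Fin m → Gr1 n) × (Fin m → ℝ) =>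
      (m : ℝ)⁻¹ * ∑ j, (inner ℝ (ω.1 j : Vec n) (covMul x (ω.1 j)))⁻¹ :=
    (Finset.measurable_sum _ fun j _ => hQ_meas.comp (by fun_prop)).const_mul _
  set G₁ : Set ((Fin m → Gr1 n) × (Fin m → ℝ)) := {ω | ∀ j, ω.2 j = 1 ∨ ω.2 j = -1}
  have p1 : initLaw n m G₁ᶜ ≤ ENNReal.ofReal 0 := by rw [measure_sign_compl]; exact zero_le
  -- Most of the failure probability goes to the kinks, where constants are tight; the
  -- inverse-variance bound has ample room.
  have p2 := measure_compl_le_of_lintegral_le (ε := 4 * ε / 5) hk_meas (by positivity)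
    (by positivity) hk
  have p3 := measure_compl_le_of_lintegral_le (ε := ε / 5) hQm_meas
    (by positivity) (by positivity) hQ
  refine ⟨_, (measurableSet_sign.inter (measurableSet_le hk_meas measurable_const)).inter
    (measurableSet_le hQm_meas measurable_const),
    (measure_compl_inter_le (by positivity) (by positivity)
      (measure_compl_inter_le le_rfl (by positivity) p1 p2) p3).trans_eq (by congr 1; ring), ?_⟩
  rintro ω ⟨⟨ha, hω2⟩, hω3⟩
  refine ⟨ha, fun hσ θ hθ hD => ?_⟩
  simp only [Set.mem_ofPred_eq] at hω2 hω3
  have hθ₀ : ∀ j, ‖(ω.1 j : Vec n)‖ = 1 := fun j => by simp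
  refine le_of_sq_le_sq ?_ (by positivity)
  refine (h.frobNorm_jacobian_sub_sq_le hLip hδ ha hθ hθ₀).trans ?_
  rcases Nat.eq_zero_or_pos m with rfl | hm
  · simp; positivity
  have hS := h.sigma0_sq_le ha hθ₀
  refine variation_terms_le hτ hε hL.le hM rfl hs hsM hn2 hN3 (by positivity) (by positivity) hD
    (S := (m : ℝ)⁻¹ * ∑ j, (inner ℝ (ω.1 j : Vec n) (covMul x (ω.1 j)))⁻¹) ?_ hω3 hω2
  · refine le_trans ?_ hS
    have : (6 * τ) ^ 2 ≤ sigma0 x ω.2 (fun j => (ω.1 j : Vec n)) ^ 2 := by gcongr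
    linarith

/-! ### Euclidean and Frobenius norms -/

section Norms
variable {ι κ : Type*} [Fintype ι] [Fintype κ]

theorem vecNorm_eq_norm (v : ι → ℝ) : vecNorm v = ‖WithLp.toLp 2 v‖ := by
  simp [vecNorm, EuclideanSpace.norm_eq]

theorem vecNorm_nonneg (v : ι → ℝ) : 0 ≤ vecNorm v := Real.sqrt_nonneg _

theorem frobNorm_nonneg (A : Matrix ι κ ℝ) : 0 ≤ frobNorm A := Real.sqrt_nonneg _

theorem vecNorm_add_le (v w : ι → ℝ) : vecNorm (v + w) ≤ vecNorm v + vecNorm w := by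
  simp only [vecNorm_eq_norm, WithLp.toLp_add]
  exact norm_add_le _ _

theorem vecNorm_smul (c : ℝ) (v : ι → ℝ) : vecNorm (c • v) = |c| * vecNorm v := by
  simp only [vecNorm_eq_norm, WithLp.toLp_smul, norm_smul, Real.norm_eq_abs]

theorem dotProduct_le_vecNorm_mul (v w : ι → ℝ) : v ⬝ᵥ w ≤ vecNorm v * vecNorm w := by
  rw [vecNorm, vecNorm, ← Real.sqrt_mul (by positivity)]
  exact Real.le_sqrt_of_sq_le (Finset.sum_mul_sq_le_sq_mul_sq _ _ _)

theorem abs_dotProduct_le_vecNorm_mul (v w : ι → ℝ) : |v ⬝ᵥ w| ≤ vecNorm v * vecNorm w := by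
  rw [vecNorm, vecNorm, ← Real.sqrt_mul (by positivity)]
  exact Real.abs_le_sqrt (Finset.sum_mul_sq_le_sq_mul_sq _ _ _)

theorem vecNorm_mulVec_le (A : Matrix ι κ ℝ) (v : κ → ℝ) :
    vecNorm (A *ᵥ v) ≤ frobNorm A * vecNorm v := by
  rw [vecNorm, vecNorm, frobNorm, ← Real.sqrt_mul (by positivity)]
  refine Real.sqrt_le_sqrt ?_
  rw [Finset.sum_mul]
  exact Finset.sum_le_sum fun i _ => Finset.sum_mul_sq_le_sq_mul_sq _ _ _

theorem frobNorm_transpose (A : Matrix ι κ ℝ) : frobNorm Aᵀ = frobNorm A := by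
  rw [frobNorm, frobNorm, Finset.sum_comm]
  rfl

theorem frobNorm_eq_vecNorm (A : Matrix ι κ ℝ) :
    frobNorm A = vecNorm fun p : ι × κ => A p.1 p.2 := by
  rw [frobNorm, vecNorm, Fintype.sum_prod_type]

theorem frobNorm_add_le (A B : Matrix ι κ ℝ) : frobNorm (A + B) ≤ frobNorm A + frobNorm B := by
  simp only [frobNorm_eq_vecNorm]
  exact vecNorm_add_le _ _

theorem frobNorm_sub_comm (A B : Matrix ι κ ℝ) : frobNorm (A - B) = frobNorm (B - A) := by
  simp only [frobNorm, Matrix.sub_apply, sub_sq_comm]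

theorem frobNorm_sub_le_add (A B C : Matrix ι κ ℝ) :
    frobNorm (A - B) ≤ frobNorm (A - C) + frobNorm (B - C) := by
  rw [frobNorm_sub_comm B C]
  simpa using frobNorm_add_le (A - C) (C - B)

/-- Minimal-norm solution of `J d = g` when `Jᵀ` is bounded below by `s`. -/
theorem mulVec_transpose_inv_gram [DecidableEq ι] {J : Matrix ι κ ℝ} {s : ℝ} (hs : 0 < s)
    (hJ : ∀ v, s * vecNorm v ≤ vecNorm (Jᵀ *ᵥ v)) :
    IsUnit (J * Jᵀ).det ∧ ∀ g, J *ᵥ (Jᵀ *ᵥ ((J * Jᵀ)⁻¹ *ᵥ g)) = g ∧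
      vecNorm (Jᵀ *ᵥ ((J * Jᵀ)⁻¹ *ᵥ g)) ≤ vecNorm g / s := by
  have hsq : ∀ v, v ⬝ᵥ ((J * Jᵀ) *ᵥ v) = vecNorm (Jᵀ *ᵥ v) ^ 2 := by
    intro v
    rw [vecNorm_sq, sum_sq_eq_dotProduct, ← Matrix.mulVec_mulVec, Matrix.dotProduct_mulVec,
      ← Matrix.mulVec_transpose]
  have hu : IsUnit (J * Jᵀ).det := by
    rw [← Matrix.isUnit_iff_isUnit_det, ← Matrix.mulVec_injective_iff_isUnit]
    rw [← Matrix.coe_mulVecLin, ← LinearMap.ker_eq_bot, LinearMap.ker_eq_bot']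
    intro v hv
    rw [Matrix.mulVecLin_apply] at hv
    have h1 := hsq v
    rw [hv, dotProduct_zero] at h1
    have h2 : vecNorm (Jᵀ *ᵥ v) = 0 := by
      rw [eq_comm, sq_eq_zero_iff] at h1; exact h1
    have h3 := hJ v
    rw [h2] at h3
    have h4 : vecNorm v = 0 :=
      le_antisymm (by by_contra hc; nlinarith [not_le.1 hc]) (vecNorm_nonneg v)
    rw [vecNorm_eq_norm, norm_eq_zero] at h4
    simpa using h4
  refine ⟨hu, fun g => ?_⟩
  have hg : J *ᵥ (Jᵀ *ᵥ ((J * Jᵀ)⁻¹ *ᵥ g)) = g := by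
    rw [Matrix.mulVec_mulVec, Matrix.mulVec_mulVec, Matrix.mul_nonsing_inv _ hu, Matrix.one_mulVec]
  refine ⟨hg, ?_⟩
  set w := (J * Jᵀ)⁻¹ *ᵥ g
  have h1 := hsq w
  rw [← Matrix.mulVec_mulVec, hg] at h1
  have h2 := dotProduct_le_vecNorm_mul w g
  have h3 := hJ w
  have hg0 := vecNorm_nonneg g
  have hd0 := vecNorm_nonneg (Jᵀ *ᵥ w)
  rw [le_div_iff₀ hs]
  by_contra hc
  have hc := not_le.1 hc
  have h4 : 0 < vecNorm (Jᵀ *ᵥ w) := by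
    rcases hd0.eq_or_lt with h | h
    · rw [← h] at hc; linarith
    · exact h
  -- With `w = (J Jᵀ)⁻¹ g`, `‖Jᵀ w‖ ^ 2 = ⟪w, g⟫ ≤ ‖w‖ ‖g‖`, and `s ‖w‖ ≤ ‖Jᵀ w‖`; one factor `‖Jᵀ
  -- w‖` then cancels.
  have h5 : vecNorm (Jᵀ *ᵥ w) ^ 2 * s ≤ vecNorm (Jᵀ *ᵥ w) * vecNorm g := by
    rw [← h1]
    calc _ ≤ vecNorm w * vecNorm g * s := by gcongr
      _ = (s * vecNorm w) * vecNorm g := by ring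
      _ ≤ _ := by gcongr
  nlinarith

end Norms

/-- Perturbation of the smallest singular value: the Frobenius norm dominates the operator norm of
the difference. -/
theorem le_vecNorm_transpose_mulVec {x : Fin N → Vec n} {a : Fin m → ℝ} {θ θ₀ : Fin m → Vec n}
    {ρ : ℝ} (h : frobNorm (jacobian x a θ - jacobian x a θ₀) ≤ ρ * sigma0 x a θ₀) (v : Fin N → ℝ) :
    (1 - ρ) * sigma0 x a θ₀ * vecNorm v ≤ vecNorm ((jacobian x a θ)ᵀ *ᵥ v) := by
  have h1 : sigma0 x a θ₀ * vecNorm v ≤ vecNorm ((jacobian x a θ₀)ᵀ *ᵥ v) := by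
    refine Real.le_sqrt_of_sq_le ?_
    rw [mul_pow, vecNorm_sq]
    exact sigma0_sq_mul_le x a θ₀ v
  have h2 : (jacobian x a θ₀)ᵀ *ᵥ v =
      (jacobian x a θ)ᵀ *ᵥ v + (jacobian x a θ₀ - jacobian x a θ)ᵀ *ᵥ v := by
    rw [Matrix.transpose_sub, Matrix.sub_mulVec]; abel
  have h3 := vecNorm_mulVec_le (jacobian x a θ₀ - jacobian x a θ)ᵀ v
  rw [frobNorm_transpose, frobNorm_sub_comm] at h3
  have h4 := vecNorm_add_le ((jacobian x a θ)ᵀ *ᵥ v) ((jacobian x a θ₀ - jacobian x a θ)ᵀ *ᵥ v)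
  rw [← h2] at h4
  have h5 := mul_le_mul_of_nonneg_right h (vecNorm_nonneg v)
  linarith

/-! ### The loss -/

namespace LossAssumption
variable {μ κL κH : ℝ} {ν : Measure ℝ} {p : ℝ → ℝ → ℝ} {x : Fin N → Vec n} {y : Fin N → ℝ}

theorem hasDerivAt_lossGrad (h : LossAssumption μ κL κH ν p m x y) (i : Fin N) (z : ℝ) :
    HasDerivAt (fun w => lossGrad p w (y i)) (lossHess p z (y i)) z := by
  have h1 : ContDiff ℝ 1 (deriv fun w => loss p w (y i)) :=
    ((contDiff_succ_iff_deriv (n := 1)).1 (by simpa using! h.smooth i)).2.2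
  exact (h1.differentiable (by simp) z).hasDerivAt

theorem abs_lossGrad_add_le (h : LossAssumption μ κL κH ν p m x y) (i : Fin N) (z w : ℝ) :
    |lossGrad p w (y i) - lossGrad p z (y i) - lossHess p z (y i) * (w - z)| ≤
      κH / 2 * (w - z) ^ 2 := by
  have hd : ∀ s : ℝ, HasDerivAt (fun s : ℝ => lossGrad p (z + s * (w - z)) (y i) -
      lossGrad p z (y i) - lossHess p z (y i) * (s * (w - z)))
      ((lossHess p (z + s * (w - z)) (y i) - lossHess p z (y i)) * (w - z)) s := by
    intro s
    have h1 : HasDerivAt (fun s : ℝ => z + s * (w - z)) (w - z) s := by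
      simpa using ((hasDerivAt_id s).mul_const (w - z)).const_add z
    have h2 := (h.hasDerivAt_lossGrad i (z + s * (w - z))).comp s h1
    have h3 : HasDerivAt (fun s : ℝ => s * (w - z)) (w - z) s := by
      simpa using (hasDerivAt_id s).mul_const (w - z)
    exact ((h2.sub_const _).sub (h3.const_mul _)).congr_deriv (by ring)
  have hB : ∀ s : ℝ, HasDerivAt (fun s : ℝ => κH / 2 * (w - z) ^ 2 * s ^ 2)
      (κH * (w - z) ^ 2 * s) s := fun s =>
    ((hasDerivAt_pow 2 s).const_mul (κH / 2 * (w - z) ^ 2)).congr_deriv (by norm_num; ring)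
  have := image_norm_le_of_norm_deriv_right_le_deriv_boundary (a := 0) (b := 1)
    (fun s _ => (hd s).continuousAt.continuousWithinAt)
    (fun s _ => (hd s).hasDerivWithinAt) (by simp) hB (fun s hs => by
      rw [Real.norm_eq_abs, abs_mul]
      have h1 := h.hess_lipschitz i (z + s * (w - z)) z
      rw [add_sub_cancel_left, abs_mul, abs_of_nonneg hs.1] at h1
      calc _ ≤ κH * (s * |w - z|) * |w - z| := by gcongr
        _ = κH * |w - z| ^ 2 * s := by ring
        _ = _ := by rw [sq_abs]) (Set.right_mem_Icc.2 zero_le_one)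
  simpa using this

theorem abs_lossGrad_le (h : LossAssumption μ κL κH ν p m x y) (i : Fin N) (z : ℝ) :
    |lossGrad p z (y i)| ≤ κL * |z - y i| := by
  have h1 := Convex.norm_image_sub_le_of_norm_hasDerivWithin_le (s := Set.univ)
    (f := fun w => lossGrad p w (y i)) (C := κL) (x := y i) (y := z)
    (fun w _ => (h.hasDerivAt_lossGrad i w).hasDerivWithinAt)
    (fun w _ => by
      rw [Real.norm_eq_abs, abs_of_nonneg (h.mu_pos.le.trans (h.hess_lower i w))]
      exact h.hess_upper i w) convex_univ trivial trivial
  simpa [h.grad_label i] using h1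

theorem lossHess_pos (h : LossAssumption μ κL κH ν p m x y) (i : Fin N) (z : ℝ) :
    0 < lossHess p z (y i) := h.mu_pos.trans_le (h.hess_lower i z)

theorem abs_newton_le (h : LossAssumption μ κL κH ν p m x y) (i : Fin N) (z : ℝ) :
    |(lossHess p z (y i))⁻¹ * lossGrad p z (y i)| ≤ κL / μ * |z - y i| := by
  have h1 := h.lossHess_pos i z
  have h0 := h.mu_pos
  rw [abs_mul, abs_of_pos (inv_pos.2 h1), div_mul_eq_mul_div, inv_mul_eq_div]
  have := h.abs_lossGrad_le i z
  gcongr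
  · have := h.kappaL_pos
    positivity
  · exact h.hess_lower i z

/-- Quadratic accuracy of a Newton step: Taylor expansion of the gradient from `z` to the label,
where the gradient vanishes, divided by the Hessian. -/
theorem abs_sub_newton_le (h : LossAssumption μ κL κH ν p m x y) (i : Fin N) (z : ℝ) :
    |(z - y i) - (lossHess p z (y i))⁻¹ * lossGrad p z (y i)| ≤
      κH / (2 * μ) * (z - y i) ^ 2 := by
  have h1 := h.lossHess_pos i z
  have h0 := h.mu_pos
  have h2 := h.abs_lossGrad_add_le i z (y i)
  rw [h.grad_label i] at h2
  have e : (z - y i) - (lossHess p z (y i))⁻¹ * lossGrad p z (y i) =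
      (lossHess p z (y i))⁻¹ *
        (0 - lossGrad p z (y i) - lossHess p z (y i) * (y i - z)) := by
    field_simp
    ring
  rw [e, abs_mul, abs_of_pos (inv_pos.2 h1), inv_mul_eq_div]
  calc _ ≤ κH / 2 * (y i - z) ^ 2 / μ := by
        gcongr
        · have := h.kappaH_pos
          positivity
        · exact h.hess_lower i z
    _ = _ := by rw [sub_sq_comm]; field_simp

end LossAssumption

/-! ### Great circles -/

section Arc
variable {E : Type*} [NormedAddCommGroup E] [InnerProductSpace ℝ E]

/-- The great circle through the unit vector `w` with initial velocity `ξ ⊥ w`. -/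
noncomputable def arc (w ξ : E) (t : ℝ) : E :=
  Real.cos (t * ‖ξ‖) • w + (Real.sin (t * ‖ξ‖) / ‖ξ‖) • ξ

/-- The velocity of `arc w ξ`. -/
noncomputable def arcVel (w ξ : E) (t : ℝ) : E :=
  -(‖ξ‖ * Real.sin (t * ‖ξ‖)) • w + Real.cos (t * ‖ξ‖) • ξ

theorem hasDerivAt_arc (w ξ : E) (t : ℝ) : HasDerivAt (arc w ξ) (arcVel w ξ t) t := by
  have h1 : HasDerivAt (fun t : ℝ => t * ‖ξ‖) ‖ξ‖ t := by
    simpa using (hasDerivAt_id t).mul_const ‖ξ‖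
  have h2 := (h1.cos.smul_const w).add ((h1.sin.div_const ‖ξ‖).smul_const ξ)
  refine h2.congr_deriv ?_
  rw [arcVel]
  by_cases h0 : ξ = 0
  · simp [h0]
  · have : ‖ξ‖ ≠ 0 := norm_ne_zero_iff.2 h0
    congr 1
    · congr 1; ring
    · congr 1; field_simp

theorem arc_zero (w ξ : E) : arc w ξ 0 = w := by simp [arc]

theorem arc_one (w ξ : E) : arc w ξ 1 = Real.cos ‖ξ‖ • w + Real.sinc ‖ξ‖ • ξ := by
  by_cases h0 : ξ = 0
  · simp [h0, arc]
  · rw [arc, one_mul, Real.sinc_of_ne_zero (norm_ne_zero_iff.2 h0)]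

theorem norm_smul_add_smul_sq {w ξ : E} (hw : ‖w‖ = 1) (h : inner ℝ w ξ = 0) (a b : ℝ) :
    ‖a • w + b • ξ‖ ^ 2 = a ^ 2 + b ^ 2 * ‖ξ‖ ^ 2 := by
  rw [norm_add_sq_real, inner_smul_left, inner_smul_right, h, norm_smul, norm_smul, hw, mul_pow,
    mul_pow, Real.norm_eq_abs, Real.norm_eq_abs, sq_abs, sq_abs]
  simp

theorem sin_div_sq_mul_sq (s c : ℝ) : (Real.sin (s * c) / c) ^ 2 * c ^ 2 = Real.sin (s * c) ^ 2 := by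
  by_cases h : c = 0
  · simp [h]
  · field_simp

theorem norm_arc {w ξ : E} (hw : ‖w‖ = 1) (h : inner ℝ w ξ = 0) (t : ℝ) : ‖arc w ξ t‖ = 1 := by
  rw [← sq_eq_sq₀ (norm_nonneg _) zero_le_one, arc, norm_smul_add_smul_sq hw h, sin_div_sq_mul_sq]
  simp

theorem norm_arcVel {w ξ : E} (hw : ‖w‖ = 1) (h : inner ℝ w ξ = 0) (t : ℝ) :
    ‖arcVel w ξ t‖ = ‖ξ‖ := by
  rw [← sq_eq_sq₀ (norm_nonneg _) (norm_nonneg _), arcVel, norm_smul_add_smul_sq hw h]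
  nlinarith [Real.sin_sq_add_cos_sq (t * ‖ξ‖)]

theorem norm_arc_sub_le {w ξ : E} (hw : ‖w‖ = 1) (h : inner ℝ w ξ = 0) {t : ℝ} (ht : 0 ≤ t) :
    ‖arc w ξ t - w‖ ≤ t * ‖ξ‖ := by
  refine le_of_sq_le_sq ?_ (by positivity)
  have e : arc w ξ t - w =
      (Real.cos (t * ‖ξ‖) - 1) • w + (Real.sin (t * ‖ξ‖) / ‖ξ‖) • ξ := by
    rw [arc, sub_smul, one_smul]; abel
  rw [e, norm_smul_add_smul_sq hw h, sin_div_sq_mul_sq]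
  nlinarith [Real.sin_sq_add_cos_sq (t * ‖ξ‖), Real.one_sub_sq_div_two_le_cos (x := t * ‖ξ‖)]

theorem norm_arcVel_sub_le {w ξ : E} (hw : ‖w‖ = 1) (h : inner ℝ w ξ = 0) {t : ℝ} (ht : 0 ≤ t) :
    ‖arcVel w ξ t - ξ‖ ≤ t * ‖ξ‖ ^ 2 := by
  refine le_of_sq_le_sq ?_ (by positivity)
  have e : arcVel w ξ t - ξ =
      (-(‖ξ‖ * Real.sin (t * ‖ξ‖))) • w + (Real.cos (t * ‖ξ‖) - 1) • ξ := by
    rw [arcVel, sub_smul, one_smul]; abel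
  rw [e, norm_smul_add_smul_sq hw h]
  have h1 := Real.sin_sq_add_cos_sq (t * ‖ξ‖)
  have h2 := Real.one_sub_sq_div_two_le_cos (x := t * ‖ξ‖)
  have h3 : (-(‖ξ‖ * Real.sin (t * ‖ξ‖))) ^ 2 + (Real.cos (t * ‖ξ‖) - 1) ^ 2 * ‖ξ‖ ^ 2 =
      ‖ξ‖ ^ 2 * (2 * (1 - Real.cos (t * ‖ξ‖))) := by
    linear_combination ‖ξ‖ ^ 2 * h1
  rw [h3]
  calc _ ≤ ‖ξ‖ ^ 2 * (2 * ((t * ‖ξ‖) ^ 2 / 2)) := by gcongr; linarith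
    _ = _ := by ring

end Arc

/-! ### The ReLU along a differentiable path -/

/-- A zero with nonzero derivative is isolated among the zeros, and a discrete subset of ℝ is
countable. -/
theorem countable_zero_ne_zero {h h' : ℝ → ℝ} (hd : ∀ t, HasDerivAt h (h' t) t) :
    {t | h t = 0 ∧ h' t ≠ 0}.Countable := by
  have : DiscreteTopology {t | h t = 0 ∧ h' t ≠ 0} := by
    rw [discreteTopology_subtype_iff]
    rintro t ⟨-, ht⟩
    rw [← Filter.empty_mem_iff_bot, Filter.mem_inf_principal]
    filter_upwards [(hd t).eventually_ne (c := 0) ht] with s hs hs'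
    exact hs hs'.1
  exact countable_of_Lindelof_of_discrete

theorem relu_eq_self {s : ℝ} (h : 0 ≤ s) : relu s = s := max_eq_left h

theorem relu_eq_zero {s : ℝ} (h : s ≤ 0) : relu s = 0 := max_eq_right h

theorem hasDerivAt_relu_comp {h : ℝ → ℝ} {h' t : ℝ} (hd : HasDerivAt h h' t)
    (ht : ¬(h t = 0 ∧ h' ≠ 0)) :
    HasDerivAt (fun s => relu (h s)) ((if 0 ≤ h t then 1 else 0) * h') t := by
  rcases lt_trichotomy (h t) 0 with h0 | h0 | h0
  · rw [if_neg (not_le.2 h0), zero_mul]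
    refine (hasDerivAt_const t (0 : ℝ)).congr_of_eventuallyEq ?_
    filter_upwards [hd.continuousAt.eventually_lt_const h0] with s hs
    exact relu_eq_zero hs.le
  -- At a degenerate zero the composite has derivative 0, since `|relu (h s)| ≤ |h s|`, which is
  -- little-o there; the value of the indicator is then irrelevant.
  · have h1 : h' = 0 := by
      by_contra hc
      exact ht ⟨h0, hc⟩
    subst h1
    rw [mul_zero]
    rw [hasDerivAt_iff_isLittleO] at hd ⊢
    refine Asymptotics.IsBigO.trans_isLittleO ?_ hd
    refine Asymptotics.IsBigO.of_bound 1 (Filter.Eventually.of_forall fun s => ?_)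
    simp only [h0, smul_zero, sub_zero, one_mul, relu_eq_zero le_rfl]
    rw [relu, Real.norm_eq_abs, Real.norm_eq_abs, abs_of_nonneg (le_max_right _ _)]
    exact max_le (le_abs_self _) (abs_nonneg _)
  · rw [if_pos h0.le, one_mul]
    refine hd.congr_of_eventuallyEq ?_
    filter_upwards [hd.continuousAt.eventually_const_lt h0] with s hs
    exact relu_eq_self hs.le

/-- The fundamental theorem of calculus with a countable exceptional set. The convention for the
ReLU derivative at 0 does not matter at zeros with vanishing velocity, and all other zeros are
exceptional; integrability needs only that `h'` is bounded and, as a derivative, measurable. -/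
theorem relu_comp_sub_eq_integral {h h' : ℝ → ℝ} (hd : ∀ t, HasDerivAt h (h' t) t) {K : ℝ}
    (hK : ∀ t, |h' t| ≤ K) :
    IntervalIntegrable (fun t => (if 0 ≤ h t then 1 else 0) * h' t) volume 0 1 ∧
    ∫ t in (0 : ℝ)..1, (if 0 ≤ h t then 1 else 0) * h' t = relu (h 1) - relu (h 0) := by
  have hcont : Continuous h := continuous_iff_continuousAt.2 fun t => (hd t).continuousAt
  have hm : Measurable fun t => (if 0 ≤ h t then (1 : ℝ) else 0) * h' t := by
    refine Measurable.mul ?_ ?_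
    · exact Measurable.ite (measurableSet_le measurable_const hcont.measurable) measurable_const
        measurable_const
    · have : h' = deriv h := funext fun t => (hd t).deriv.symm
      rw [this]
      exact measurable_deriv h
  have hint : IntervalIntegrable (fun t => (if 0 ≤ h t then (1 : ℝ) else 0) * h' t) volume 0 1 := by
    refine (intervalIntegrable_const (c := K)).mono_fun hm.aestronglyMeasurable ?_
    refine Filter.Eventually.of_forall fun t => ?_
    have h1 := hK t
    have h0 := abs_nonneg (h' t)
    simp only [Real.norm_eq_abs, abs_of_nonneg (h0.trans h1)]
    split_ifs
    · simpa using h1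
    · simpa using h0.trans h1
  refine ⟨hint, integral_eq_of_hasDerivAt_off_countable (fun t => relu (h t)) _
    (countable_zero_ne_zero hd) ?_ (fun t ht => hasDerivAt_relu_comp (hd t) ht.2) hint⟩
  exact (hcont.max continuous_const).continuousOn

/-! ### The network along a geodesic -/

/-- The vector of `ℝ^{mn}` made of the `m` blocks `ξ_j`. -/
def flat (ξ : Fin m → Vec n) : Fin m × Fin n → ℝ := fun p => ξ p.1 p.2

theorem vecNorm_flat_sq (ξ : Fin m → Vec n) : vecNorm (flat ξ) ^ 2 = ∑ j, ‖ξ j‖ ^ 2 := by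
  rw [vecNorm_sq, Fintype.sum_prod_type]
  refine Finset.sum_congr rfl fun j _ => ?_
  rw [EuclideanSpace.norm_sq_eq]
  simp [flat]

theorem sphereExp_eq_arc (θ ξ : Fin m → Vec n) : sphereExp θ ξ = fun j => arc (θ j) (ξ j) 1 := by
  ext1 j
  rw [sphereExp, arc_one]

theorem jacobian_mulVec_flat (x : Fin N → Vec n) (a : Fin m → ℝ) (θ ξ : Fin m → Vec n) (i : Fin N) :
    (jacobian x a θ *ᵥ flat ξ) i = (√(m : ℝ))⁻¹ * ∑ j, a j *
      ((if 0 ≤ (inner ℝ (θ j) (x i - mean x) : ℝ) then 1 else 0) *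
        inner ℝ (preActGrad x i (θ j)) (ξ j)) := by
  simp only [Matrix.mulVec, dotProduct]
  rw [Fintype.sum_prod_type, Finset.mul_sum]
  refine Finset.sum_congr rfl fun j _ => ?_
  rw [inner_eq_dotProduct (preActGrad x i (θ j)), dotProduct]
  simp only [jacobian, Matrix.of_apply, flat, Finset.mul_sum]
  exact Finset.sum_congr rfl fun l _ => by ring

theorem DataAssumption.output_sphereExp_sub {B : ℝ} {x : Fin N → Vec n} {y : Fin N → ℝ}
    (h : DataAssumption B x y) (a : Fin m → ℝ) {θ ξ : Fin m → Vec n} (hθ : ∀ j, ‖θ j‖ = 1)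
    (hξ : ∀ j, inner ℝ (θ j) (ξ j) = 0) (i : Fin N) :
    IntervalIntegrable (fun t => (jacobian x a (fun j => arc (θ j) (ξ j) t) *ᵥ
      flat fun j => arcVel (θ j) (ξ j) t) i) volume 0 1 ∧
    ∫ t in (0 : ℝ)..1, (jacobian x a (fun j => arc (θ j) (ξ j) t) *ᵥ
      flat fun j => arcVel (θ j) (ξ j) t) i = output x a (sphereExp θ ξ) i - output x a θ i := by
  have hd : ∀ j t, HasDerivAt (fun t => preAct x i (arc (θ j) (ξ j) t))
      (inner ℝ (preActGrad x i (arc (θ j) (ξ j) t)) (arcVel (θ j) (ξ j) t)) t := by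
    intro j t
    have h1 := (hasGradientAt_preAct x i _
      (h.inner_covMul_pos _ (norm_arc (hθ j) (hξ j) t))).hasFDerivAt
    exact h1.comp_hasDerivAt t (hasDerivAt_arc (θ j) (ξ j) t)
  have hb : ∀ j t, |(inner ℝ (preActGrad x i (arc (θ j) (ξ j) t)) (arcVel (θ j) (ξ j) t) : ℝ)| ≤
      √(gradBound x) * ‖ξ j‖ := by
    intro j t
    refine (abs_real_inner_le_norm _ _).trans ?_
    rw [norm_arcVel (hθ j) (hξ j)]
    gcongr
    exact Real.le_sqrt_of_sq_le (h.norm_preActGrad_sq_le i _ (norm_arc (hθ j) (hξ j) t))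
  have hsign : ∀ j t, (0 ≤ (inner ℝ (arc (θ j) (ξ j) t) (x i - mean x) : ℝ)) =
      (0 ≤ preAct x i (arc (θ j) (ξ j) t)) := by
    intro j t
    have h0 : 0 < stdDev x (arc (θ j) (ξ j) t) :=
      Real.sqrt_pos.2 (h.inner_covMul_pos _ (norm_arc (hθ j) (hξ j) t))
    rw [preAct, le_div_iff₀ h0, zero_mul]
  have key := fun j => relu_comp_sub_eq_integral (hd j) (hb j)
  simp only [jacobian_mulVec_flat, hsign]
  constructor
  · refine IntervalIntegrable.const_mul ?_ _
    have := IntervalIntegrable.sum Finset.univ fun j _ => (key j).1.const_mul (a j)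
    simpa only [Finset.sum_fn] using this
  · rw [intervalIntegral.integral_const_mul,
      intervalIntegral.integral_finsetSum fun j _ => (key j).1.const_mul _]
    simp only [intervalIntegral.integral_const_mul, (key _).2]
    rw [output, output, ← mul_sub, ← Finset.sum_sub_distrib, sphereExp_eq_arc]
    simp only [arc_zero, mul_sub]

theorem DataAssumption.vecNorm_output_sphereExp_sub_le {B : ℝ} {x : Fin N → Vec n} {y : Fin N → ℝ}
    (h : DataAssumption B x y) (a : Fin m → ℝ) {θ ξ : Fin m → Vec n} (hθ : ∀ j, ‖θ j‖ = 1)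
    (hξ : ∀ j, inner ℝ (θ j) (ξ j) = 0) {K : ℝ}
    (hK : ∀ t ∈ Set.Icc (0 : ℝ) 1, vecNorm (jacobian x a (fun j => arc (θ j) (ξ j) t) *ᵥ
      (flat fun j => arcVel (θ j) (ξ j) t) - jacobian x a θ *ᵥ flat ξ) ≤ K) :
    vecNorm (output x a (sphereExp θ ξ) - output x a θ - jacobian x a θ *ᵥ flat ξ) ≤ K := by
  set e := output x a (sphereExp θ ξ) - output x a θ - jacobian x a θ *ᵥ flat ξ with he
  set v : ℝ → Fin N → ℝ := fun t => jacobian x a (fun j => arc (θ j) (ξ j) t) *ᵥ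
      (flat fun j => arcVel (θ j) (ξ j) t) - jacobian x a θ *ᵥ flat ξ with hv
  have key := fun i => h.output_sphereExp_sub a hθ hξ i
  have hvi : ∀ i, IntervalIntegrable (fun t => v t i) volume 0 1 := fun i =>
    (key i).1.sub intervalIntegrable_const
  have hei : ∀ i, ∫ t in (0 : ℝ)..1, v t i = e i := by
    intro i
    simp only [hv, Pi.sub_apply]
    rw [intervalIntegral.integral_sub (key i).1 intervalIntegrable_const, (key i).2]
    simp [he]
  -- Pairing with the error vector `e` itself reduces the norm estimate to scalar integrals: `‖e‖ ^
  -- 2 ≤ ‖e‖ * K`.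
  have h1 : ∫ t in (0 : ℝ)..1, e ⬝ᵥ v t = vecNorm e ^ 2 := by
    simp only [dotProduct]
    rw [intervalIntegral.integral_finsetSum fun i _ => (hvi i).const_mul _]
    simp only [intervalIntegral.integral_const_mul, hei]
    rw [vecNorm_sq]
    exact Finset.sum_congr rfl fun i _ => by ring
  have h2 : ‖∫ t in (0 : ℝ)..1, e ⬝ᵥ v t‖ ≤ vecNorm e * K * |1 - 0| := by
    refine intervalIntegral.norm_integral_le_of_norm_le_const fun t ht => ?_
    rw [Set.uIoc_of_le zero_le_one] at ht
    refine (abs_dotProduct_le_vecNorm_mul e (v t)).trans ?_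
    exact mul_le_mul_of_nonneg_left (hK t ⟨ht.1.le, ht.2⟩) (vecNorm_nonneg e)
  rw [h1, Real.norm_eq_abs, abs_of_nonneg (sq_nonneg _)] at h2
  simp only [sub_zero, abs_one, mul_one] at h2
  have hK0 : 0 ≤ K := (vecNorm_nonneg _).trans (hK 0 (by simp))
  have h0 := vecNorm_nonneg e
  by_contra hc
  nlinarith [not_le.1 hc]

/-! ### One step of the Riemannian natural gradient method -/

theorem inner_transpose_jacobian_mulVec {x : Fin N → Vec n} {a : Fin m → ℝ} {θ : Fin m → Vec n}
    (j : Fin m) (hθ : 0 < inner ℝ (θ j) (covMul x (θ j))) (w : Fin N → ℝ) :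
    inner ℝ (θ j) (WithLp.toLp 2 fun l => ((jacobian x a θ)ᵀ *ᵥ w) (j, l)) = 0 := by
  have e : (WithLp.toLp 2 fun l => ((jacobian x a θ)ᵀ *ᵥ w) (j, l)) =
      ∑ i, (w i * ((√(m : ℝ))⁻¹ * a j *
        (if 0 ≤ inner ℝ (θ j) (x i - mean x) then 1 else 0))) • preActGrad x i (θ j) := by
    ext l
    simp only [Matrix.mulVec, dotProduct, Matrix.transpose_apply, jacobian, Matrix.of_apply,
      WithLp.ofLp_sum, Finset.sum_apply, WithLp.ofLp_smul, Pi.smul_apply, smul_eq_mul]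
    exact Finset.sum_congr rfl fun i _ => by ring
  rw [e, inner_sum]
  refine Finset.sum_eq_zero fun i _ => ?_
  rw [inner_smul_right, inner_preActGrad x i _ hθ, mul_zero]

theorem inv_diagonal_of_ne_zero {ι : Type*} [Fintype ι] [DecidableEq ι] {f : ι → ℝ}
    (hf : ∀ i, f i ≠ 0) : (Matrix.diagonal f)⁻¹ = Matrix.diagonal fun i => (f i)⁻¹ := by
  refine Matrix.inv_eq_right_inv ?_
  rw [Matrix.diagonal_mul_diagonal, ← Matrix.diagonal_one]
  congr 1
  ext i
  exact mul_inv_cancel₀ (hf i)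

/-- The trailing `(J Jᵀ)⁻¹ J` of the pseudo-inverse cancels against `Jᵀ`, and the Fisher information
is the Hessian. What remains is the minimal-norm preimage under `J` of the Newton direction in
output space. -/
theorem LossAssumption.rngdDirection_eq {μ κL κH : ℝ} {ν : Measure ℝ} {p : ℝ → ℝ → ℝ}
    {x : Fin N → Vec n} {y : Fin N → ℝ} (h : LossAssumption μ κL κH ν p m x y) {a : Fin m → ℝ}
    (ha : ∀ j, a j = 1 ∨ a j = -1) {θ : Fin m → Vec n} (hθ : ∀ j, ‖θ j‖ = 1)
    (hu : IsUnit (jacobian x a θ * (jacobian x a θ)ᵀ).det) :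
    rngdDirection ν p x y a θ = (jacobian x a θ)ᵀ *ᵥ ((jacobian x a θ * (jacobian x a θ)ᵀ)⁻¹ *ᵥ
      fun i => (lossHess p (output x a θ i) (y i))⁻¹ * lossGrad p (output x a θ i) (y i)) := by
  have hH : (Matrix.diagonal fun i => fisherLoss ν p (output x a θ i))⁻¹ =
      Matrix.diagonal fun i => (lossHess p (output x a θ i) (y i))⁻¹ := by
    simp only [h.fisher_eq_hess a θ ha hθ]
    exact inv_diagonal_of_ne_zero fun i => (h.lossHess_pos i _).ne'
  simp only [rngdDirection, fisherPinv, hH]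
  set J := jacobian x a θ
  set G : Fin N → ℝ := fun i => lossGrad p (output x a θ i) (y i)
  have e1 : (J * Jᵀ)⁻¹ *ᵥ (J *ᵥ (Jᵀ *ᵥ G)) = G := by
    rw [Matrix.mulVec_mulVec (M := J), Matrix.mulVec_mulVec, Matrix.nonsing_inv_mul _ hu,
      Matrix.one_mulVec]
  rw [← Matrix.mulVec_mulVec, ← Matrix.mulVec_mulVec, ← Matrix.mulVec_mulVec, e1,
    ← Matrix.mulVec_mulVec]
  congr 2
  ext i
  rw [Matrix.mulVec_diagonal]

theorem weightDist_triangle (θ θ' θ'' : Fin m → Vec n) :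
    weightDist θ θ'' ≤ weightDist θ θ' + weightDist θ' θ'' := by
  have e : ∀ θ θ' : Fin m → Vec n, weightDist θ θ' =
      dist (WithLp.toLp 2 θ : PiLp 2 fun _ : Fin m => Vec n) (WithLp.toLp 2 θ') := by
    intro θ θ'
    rw [PiLp.dist_eq_of_L2, weightDist]
    simp only [dist_eq_norm]
  simp only [e]
  exact dist_triangle _ _ _

theorem weightDist_self (θ : Fin m → Vec n) : weightDist θ θ = 0 := by simp [weightDist]

theorem weightDist_arc_le {θ ξ : Fin m → Vec n} (hθ : ∀ j, ‖θ j‖ = 1)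
    (hξ : ∀ j, inner ℝ (θ j) (ξ j) = 0) {t : ℝ} (ht : t ∈ Set.Icc (0 : ℝ) 1) :
    weightDist (fun j => arc (θ j) (ξ j) t) θ ≤ vecNorm (flat ξ) := by
  refine le_of_sq_le_sq ?_ (vecNorm_nonneg _)
  rw [weightDist_sq, vecNorm_flat_sq]
  refine Finset.sum_le_sum fun j _ => ?_
  have h1 := norm_arc_sub_le (hθ j) (hξ j) ht.1
  have h2 : t * ‖ξ j‖ ≤ 1 * ‖ξ j‖ := mul_le_mul_of_nonneg_right ht.2 (norm_nonneg _)
  rw [one_mul] at h2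
  gcongr
  exact h1.trans h2

theorem vecNorm_flat_arcVel {θ ξ : Fin m → Vec n} (hθ : ∀ j, ‖θ j‖ = 1)
    (hξ : ∀ j, inner ℝ (θ j) (ξ j) = 0) (t : ℝ) :
    vecNorm (flat fun j => arcVel (θ j) (ξ j) t) = vecNorm (flat ξ) := by
  rw [← sq_eq_sq₀ (vecNorm_nonneg _) (vecNorm_nonneg _), vecNorm_flat_sq, vecNorm_flat_sq]
  exact Finset.sum_congr rfl fun j _ => by rw [norm_arcVel (hθ j) (hξ j)]

theorem sum_sq_sq_le_sq_sum_sq {ι : Type*} [Fintype ι] (v : ι → ℝ) :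
    ∑ i, (v i ^ 2) ^ 2 ≤ (∑ i, v i ^ 2) ^ 2 := by
  rw [pow_two (∑ i, v i ^ 2), Finset.sum_mul]
  refine Finset.sum_le_sum fun i _ => ?_
  rw [pow_two (v i ^ 2)]
  gcongr
  exact Finset.single_le_sum (fun i _ => sq_nonneg (v i)) (Finset.mem_univ i)

theorem vecNorm_flat_arcVel_sub_le {θ ξ : Fin m → Vec n} (hθ : ∀ j, ‖θ j‖ = 1)
    (hξ : ∀ j, inner ℝ (θ j) (ξ j) = 0) {t : ℝ} (ht : t ∈ Set.Icc (0 : ℝ) 1) :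
    vecNorm ((flat fun j => arcVel (θ j) (ξ j) t) - flat ξ) ≤ vecNorm (flat ξ) ^ 2 := by
  have e : (flat fun j => arcVel (θ j) (ξ j) t) - flat ξ =
      flat fun j => arcVel (θ j) (ξ j) t - ξ j := by
    ext p; simp [flat]
  refine le_of_sq_le_sq ?_ (sq_nonneg _)
  rw [e, vecNorm_flat_sq, vecNorm_flat_sq]
  refine le_trans (Finset.sum_le_sum fun j _ => ?_) (sum_sq_sq_le_sq_sum_sq fun j => ‖ξ j‖)
  have h1 := norm_arcVel_sub_le (hθ j) (hξ j) ht.1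
  have h2 : t * ‖ξ j‖ ^ 2 ≤ 1 * ‖ξ j‖ ^ 2 := mul_le_mul_of_nonneg_right ht.2 (sq_nonneg _)
  rw [one_mul] at h2
  gcongr
  exact h1.trans h2

theorem LossAssumption.vecNorm_newton_le {μ κL κH : ℝ} {ν : Measure ℝ} {p : ℝ → ℝ → ℝ}
    {x : Fin N → Vec n} {y : Fin N → ℝ} (h : LossAssumption μ κL κH ν p m x y) (u : Fin N → ℝ) :
    vecNorm (fun i => (lossHess p (u i) (y i))⁻¹ * lossGrad p (u i) (y i)) ≤
      κL / μ * vecNorm (u - y) := by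
  have h0 : 0 ≤ κL / μ := (div_pos h.kappaL_pos h.mu_pos).le
  refine le_of_sq_le_sq ?_ (mul_nonneg h0 (vecNorm_nonneg _))
  rw [mul_pow, vecNorm_sq, vecNorm_sq, Finset.mul_sum]
  refine Finset.sum_le_sum fun i _ => ?_
  rw [← mul_pow, ← sq_abs, ← sq_abs (κL / μ * _), abs_mul (κL / μ), abs_of_nonneg h0]
  have := h.abs_newton_le i (u i)
  gcongr
  exact this

theorem LossAssumption.vecNorm_sub_newton_le {μ κL κH : ℝ} {ν : Measure ℝ} {p : ℝ → ℝ → ℝ}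
    {x : Fin N → Vec n} {y : Fin N → ℝ} (h : LossAssumption μ κL κH ν p m x y) (u : Fin N → ℝ) :
    vecNorm ((u - y) - fun i => (lossHess p (u i) (y i))⁻¹ * lossGrad p (u i) (y i)) ≤
      κH / (2 * μ) * vecNorm (u - y) ^ 2 := by
  have hH := h.kappaH_pos
  have hm := h.mu_pos
  refine le_of_sq_le_sq ?_ (by positivity)
  rw [mul_pow, vecNorm_sq, vecNorm_sq]
  refine le_trans ?_ (mul_le_mul_of_nonneg_left (sum_sq_sq_le_sq_sum_sq (u - y)) (by positivity))
  rw [Finset.mul_sum]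
  refine Finset.sum_le_sum fun i _ => ?_
  rw [← mul_pow, ← sq_abs]
  have := h.abs_sub_newton_le i (u i)
  simp only [Pi.sub_apply]
  gcongr

/-- The scalar inequality behind the contraction of the residual. -/
theorem contraction_bound {μ κL κH σ F ρ η r r₀ D : ℝ} (hμ : 0 < μ) (hκL : 0 < κL) (hκH : 0 < κH)
    (hσ : 0 < σ) (hF : 0 ≤ F) (hρ0 : 0 ≤ ρ) (hρ : ρ ≤ 2 / 15) (hρκ : ρ * κL ≤ 2 / 15 * μ)
    (hη : 0 < η) (hr : 0 ≤ r) (hrr : r ≤ r₀) (hD0 : 0 ≤ D)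
    (hD : D ≤ κL / μ * r / ((1 - ρ) * σ))
    (hstep : r₀ ≠ 0 → η ≤ (1 / (6 * r₀) - κH / (2 * μ)) *
      (3 * μ ^ 2 * σ / (8 * (1 * (1 / 4 + F / (2 * σ))) * κL ^ 2))) :
    (1 - η) * r + η * (κH / (2 * μ) * r ^ 2) +
      (2 * (ρ * σ) * (η * D) + (F + ρ * σ) * (η * D) ^ 2) ≤ (1 - η / 2) * r := by
  -- The slack `4/5` in the stability constant enters here: `ρ = 4c/5 ≤ 2/15` gives `1/(1 - ρ) ≤
  -- 15/13`. Then the linear error is at most `4/13`, below `1/2 - 1/6`, and `2 * (15/13) ^ 2 =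
  -- 450/169 ≤ 8/3` matches the step-size condition. With `ρ = 1/6` both would fail.
  have hD' : D ≤ 15 / 13 * (κL / (μ * σ)) * r := by
    refine hD.trans ?_
    calc κL / μ * r / ((1 - ρ) * σ) ≤ κL / μ * r / (13 / 15 * σ) := by
          gcongr; linarith
      _ = _ := by field_simp
  set R := 1 / 4 + F / (2 * σ) with hR
  have hR0 : 0 < R := by positivity
  -- The step-size bound, multiplied by `r₀`: the Newton and curvature errors together may use `1/6`
  -- of the rate.
  have hbud : κH / (2 * μ) * r₀ + 8 * R * κL ^ 2 / (3 * μ ^ 2 * σ) * η * r₀ ≤ 1 / 6 := by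
    rcases (hr.trans hrr).eq_or_lt with h | h
    · rw [← h]; norm_num
    · have h1 := hstep h.ne'
      rw [one_mul] at h1
      have h2 : 8 * R * κL ^ 2 / (3 * μ ^ 2 * σ) * η * r₀ ≤ (1 / (6 * r₀) - κH / (2 * μ)) * r₀ := by
        refine mul_le_mul_of_nonneg_right ?_ h.le
        calc _ ≤ 8 * R * κL ^ 2 / (3 * μ ^ 2 * σ) * ((1 / (6 * r₀) - κH / (2 * μ)) *
              (3 * μ ^ 2 * σ / (8 * R * κL ^ 2))) := by gcongr
          _ = _ := by field_simp
      have h3 : (1 / (6 * r₀) - κH / (2 * μ)) * r₀ = 1 / 6 - κH / (2 * μ) * r₀ := by field_simp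
      linarith
  have t1 : 2 * (ρ * σ) * (η * D) ≤ 4 / 13 * (η * r) := by
    calc _ ≤ 2 * (ρ * σ) * (η * (15 / 13 * (κL / (μ * σ)) * r)) := by gcongr
      _ = 30 / 13 * ((ρ * κL) / μ) * (η * r) := by field_simp; ring
      _ ≤ 30 / 13 * ((2 / 15 * μ) / μ) * (η * r) := by gcongr
      _ = _ := by field_simp; ring
  have t2 : (F + ρ * σ) * (η * D) ^ 2 ≤ 8 * R * κL ^ 2 / (3 * μ ^ 2 * σ) * η * r₀ * (η * r) := by
    have h1 : F + ρ * σ ≤ 2 * σ * R := by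
      have : 2 * σ * R = σ / 2 + F := by rw [hR]; field_simp; ring
      rw [this]
      nlinarith
    calc _ ≤ (2 * σ * R) * (η * (15 / 13 * (κL / (μ * σ)) * r)) ^ 2 := by gcongr
      _ = 450 / 169 * (R * κL ^ 2 / (μ ^ 2 * σ) * η * r) * (η * r) := by field_simp; ring
      _ ≤ 8 / 3 * (R * κL ^ 2 / (μ ^ 2 * σ) * η * r₀) * (η * r) :=
          mul_le_mul_of_nonneg_right (mul_le_mul (by norm_num) (by gcongr) (by positivity)
            (by norm_num)) (by positivity)
      _ = _ := by field_simp
  have t3 : η * (κH / (2 * μ) * r ^ 2) ≤ κH / (2 * μ) * r₀ * (η * r) := by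
    calc _ = κH / (2 * μ) * r * (η * r) := by ring
      _ ≤ _ := by gcongr
  have h5 : 0 ≤ η * r := by positivity
  have h6 := mul_le_mul_of_nonneg_right hbud h5
  linarith

/-- The hypothesis `hinv` is a potential: distance from the start plus a multiple of the residual. A
step moves the weights by at most that multiple of `η/2 * r`, exactly the amount of residual the
contraction removes, so the potential does not grow and the next iterate stays in the stability
ball. -/
theorem rngd_step {B μ κL κH η : ℝ} {ν : Measure ℝ} {p : ℝ → ℝ → ℝ} {x : Fin N → Vec n}
    {y : Fin N → ℝ} (h : DataAssumption B x y) (hl : LossAssumption μ κL κH ν p m x y)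
    {a : Fin m → ℝ} (ha : ∀ j, a j = 1 ∨ a j = -1) {θ₀ θ : Fin m → Vec n}
    (hσ : 0 < sigma0 x a θ₀)
    (hstab : ∀ θ : Fin m → Vec n, (∀ j, ‖θ j‖ = 1) →
      weightDist θ θ₀ ≤ 4 * κL * (μ * sigma0 x a θ₀)⁻¹ * residual x y a θ₀ →
      frobNorm (jacobian x a θ - jacobian x a θ₀) ≤
        4 / 5 * min (1 / 2) (μ / (6 * κL)) * sigma0 x a θ₀)
    (hη : 0 < η) (hη1 : η ≤ 1)
    (hstep : residual x y a θ₀ ≠ 0 → η ≤ (1 / (6 * residual x y a θ₀) - κH / (2 * μ)) *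
      (3 * μ ^ 2 * sigma0 x a θ₀ / (8 * (1 * (1 / 4 + frobNorm (jacobian x a θ₀) /
        (2 * sigma0 x a θ₀))) * κL ^ 2)))
    (hθ : ∀ j, ‖θ j‖ = 1)
    (hinv : weightDist θ θ₀ + 4 * κL * (μ * sigma0 x a θ₀)⁻¹ * residual x y a θ ≤
      4 * κL * (μ * sigma0 x a θ₀)⁻¹ * residual x y a θ₀)
    {θ' : Fin m → Vec n} (hθ' : θ' = sphereExp θ fun j =>
      WithLp.toLp 2 fun l => -η * rngdDirection ν p x y a θ (j, l)) :
    (∀ j, ‖θ' j‖ = 1) ∧ residual x y a θ' ≤ (1 - η / 2) * residual x y a θ ∧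
      weightDist θ' θ₀ + 4 * κL * (μ * sigma0 x a θ₀)⁻¹ * residual x y a θ' ≤
        4 * κL * (μ * sigma0 x a θ₀)⁻¹ * residual x y a θ₀ := by
  set σ := sigma0 x a θ₀
  set c := min (1 / 2) (μ / (6 * κL))
  set J := jacobian x a θ with hJ
  set r := residual x y a θ with hr
  set r₀ := residual x y a θ₀
  set Cc := 4 * κL * (μ * σ)⁻¹ with hCc
  have hμ := hl.mu_pos
  have hκL := hl.kappaL_pos
  have hκH := hl.kappaH_pos
  have hCc0 : 0 < Cc := by positivity
  have i0 : Fin N := ⟨0, h.nonempty⟩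
  have hμκ : μ ≤ κL := (hl.hess_lower i0 0).trans (hl.hess_upper i0 0)
  have hc0 : 0 < c := lt_min (by norm_num) (by positivity)
  have hcκ : c * κL ≤ μ / 6 := by
    calc c * κL ≤ μ / (6 * κL) * κL := by gcongr; exact min_le_right _ _
      _ = μ / 6 := by field_simp
  have hc6 : c ≤ 1 / 6 := by
    refine (min_le_right _ _).trans ?_
    rw [div_le_div_iff₀ (by positivity) (by norm_num)]
    linarith
  have hr0 : 0 ≤ r := vecNorm_nonneg _
  have hw0 := weightDist_nonneg θ θ₀
  have hrr : r ≤ r₀ := by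
    have : Cc * r ≤ Cc * r₀ := by linarith
    exact le_of_mul_le_mul_left this hCc0
  have hJ0 := hstab θ hθ (by nlinarith)
  obtain ⟨hdet, hd⟩ := mulVec_transpose_inv_gram (J := J) (s := (1 - 4 / 5 * c) * σ)
    (mul_pos (by linarith) hσ) (le_vecNorm_transpose_mulVec hJ0)
  obtain ⟨hJd, hdn⟩ := hd fun i => (lossHess p (output x a θ i) (y i))⁻¹ *
    lossGrad p (output x a θ i) (y i)
  rw [← hl.rngdDirection_eq ha hθ hdet] at hJd hdn
  have hdir := hl.rngdDirection_eq ha hθ hdet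
  set d := rngdDirection ν p x y a θ
  set g : Fin N → ℝ := fun i => (lossHess p (output x a θ i) (y i))⁻¹ *
    lossGrad p (output x a θ i) (y i)
  have hgn : vecNorm g ≤ κL / μ * r := hl.vecNorm_newton_le (output x a θ)
  have hD : vecNorm d ≤ κL / μ * r / ((1 - 4 / 5 * c) * σ) := by
    refine hdn.trans ?_
    have : 0 < 1 - 4 / 5 * c := by linarith
    gcongr
  set ξ : Fin m → Vec n := fun j => WithLp.toLp 2 fun l => -η * d (j, l) with hξ_def
  have hflat : flat ξ = (-η) • d := by ext q; simp [flat, ξ]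
  have hξn : vecNorm (flat ξ) = η * vecNorm d := by
    rw [hflat, vecNorm_smul, abs_neg, abs_of_pos hη]
  have hJξ : J *ᵥ flat ξ = (-η) • g := by rw [hflat, Matrix.mulVec_smul, hJd]
  have hξ : ∀ j, inner ℝ (θ j) (ξ j) = 0 := by
    intro j
    have e : ξ j = (-η) • (WithLp.toLp 2 fun l => d (j, l) : Vec n) := by
      ext l; simp [ξ]
    rw [e, inner_smul_right, hdir,
      inner_transpose_jacobian_mulVec j (h.inner_covMul_pos _ (hθ j)), mul_zero]
  have hD0 := vecNorm_nonneg d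
  have hmove : η * vecNorm d ≤ Cc * (η / 2 * r) := by
    have h1 : vecNorm d ≤ 2 * κL / (μ * σ) * r := by
      refine hD.trans ?_
      calc _ ≤ κL / μ * r / (1 / 2 * σ) := by gcongr; linarith
        _ = _ := by field_simp
    calc η * vecNorm d ≤ η * (2 * κL / (μ * σ) * r) := by gcongr
      _ = _ := by rw [hCc]; field_simp; ring
  have hmove' : η * vecNorm d ≤ Cc * r := by
    refine hmove.trans (mul_le_mul_of_nonneg_left ?_ hCc0.le)
    nlinarith
  -- The whole geodesic, not just its endpoint, must lie in the ball; the displacement is at most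
  -- `Cc * r`, which `hinv` leaves available.
  have hpath : ∀ t ∈ Set.Icc (0 : ℝ) 1,
      frobNorm (jacobian x a (fun j => arc (θ j) (ξ j) t) - jacobian x a θ₀) ≤ 4 / 5 * c * σ := by
    intro t ht
    refine hstab _ (fun j => norm_arc (hθ j) (hξ j) t) ?_
    have h1 := weightDist_triangle (fun j => arc (θ j) (ξ j) t) θ θ₀
    have h2 := weightDist_arc_le hθ hξ ht
    rw [hξn] at h2
    linarith
  have hF : frobNorm J ≤ frobNorm (jacobian x a θ₀) + 4 / 5 * c * σ := by
    have := frobNorm_add_le (jacobian x a θ₀) (J - jacobian x a θ₀)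
    rw [add_sub_cancel] at this
    linarith
  have hK : ∀ t ∈ Set.Icc (0 : ℝ) 1, vecNorm (jacobian x a (fun j => arc (θ j) (ξ j) t) *ᵥ
      (flat fun j => arcVel (θ j) (ξ j) t) - J *ᵥ flat ξ) ≤
      2 * (4 / 5 * c * σ) * (η * vecNorm d) +
        (frobNorm (jacobian x a θ₀) + 4 / 5 * c * σ) * (η * vecNorm d) ^ 2 := by
    intro t ht
    -- Splitting into Jacobian variation times velocity, and Jacobian times the turning of the
    -- velocity. The first is linear in the step length, the second quadratic.
    have e : jacobian x a (fun j => arc (θ j) (ξ j) t) *ᵥ (flat fun j => arcVel (θ j) (ξ j) t) -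
        J *ᵥ flat ξ = (jacobian x a (fun j => arc (θ j) (ξ j) t) - J) *ᵥ
          (flat fun j => arcVel (θ j) (ξ j) t) +
        J *ᵥ ((flat fun j => arcVel (θ j) (ξ j) t) - flat ξ) := by
      rw [Matrix.sub_mulVec, Matrix.mulVec_sub]; abel
    rw [e]
    refine (vecNorm_add_le _ _).trans (add_le_add ?_ ?_)
    · refine (vecNorm_mulVec_le _ _).trans ?_
      rw [vecNorm_flat_arcVel hθ hξ, hξn]
      have := frobNorm_sub_le_add (jacobian x a (fun j => arc (θ j) (ξ j) t)) J (jacobian x a θ₀)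
      have := hpath t ht
      gcongr
      linarith
    · refine (vecNorm_mulVec_le _ _).trans ?_
      have h1 := vecNorm_flat_arcVel_sub_le hθ hξ ht
      rw [hξn] at h1
      exact mul_le_mul hF h1 (vecNorm_nonneg _) ((frobNorm_nonneg J).trans hF)
  have he := h.vecNorm_output_sphereExp_sub_le a hθ hξ hK
  have hunit : ∀ j, ‖θ' j‖ = 1 := by
    intro j
    rw [hθ', sphereExp_eq_arc]
    exact norm_arc (hθ j) (hξ j) 1
  have hcontr : residual x y a θ' ≤ (1 - η / 2) * r := by
    -- A damped Newton step in output space, with the Newton error and the linearization error along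
    -- the geodesic separated.
    have e : output x a θ' - y = (1 - η) • (output x a θ - y) +
        (η • ((output x a θ - y) - g) + (output x a θ' - output x a θ - J *ᵥ flat ξ)) := by
      rw [hJξ]
      ext i
      simp only [Pi.add_apply, Pi.sub_apply, Pi.smul_apply, smul_eq_mul]
      ring
    rw [residual, e]
    have h1 := vecNorm_add_le ((1 - η) • (output x a θ - y))
      (η • ((output x a θ - y) - g) + (output x a θ' - output x a θ - J *ᵥ flat ξ))
    have h2 := vecNorm_add_le (η • ((output x a θ - y) - g))
      (output x a θ' - output x a θ - J *ᵥ flat ξ)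
    rw [vecNorm_smul, abs_of_nonneg (by linarith : 0 ≤ 1 - η)] at h1
    rw [vecNorm_smul, abs_of_pos hη] at h2
    have h3 := mul_le_mul_of_nonneg_left (hl.vecNorm_sub_newton_le (output x a θ)) hη.le
    rw [← hθ'] at he
    have h4 := contraction_bound (r := r) (D := vecNorm d) hμ hκL hκH hσ (frobNorm_nonneg _)
      (by positivity) (by linarith) (by linarith) hη hr0 hrr hD0 hD hstep
    have h5 : vecNorm (output x a θ - y) = r := rfl
    rw [h5] at h1 h3
    linarith
  refine ⟨hunit, hcontr, ?_⟩
  have h1 := weightDist_triangle θ' θ θ₀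
  have h2 := weightDist_arc_le hθ hξ (t := 1) (by simp)
  rw [← sphereExp_eq_arc, ← hθ', hξn] at h2
  have h3 := mul_le_mul_of_nonneg_left hcontr hCc0.le
  linarith

theorem rngd_residual_le {B μ κL κH η : ℝ} {ν : Measure ℝ} {p : ℝ → ℝ → ℝ} {x : Fin N → Vec n}
    {y : Fin N → ℝ} (h : DataAssumption B x y) (hl : LossAssumption μ κL κH ν p m x y)
    {a : Fin m → ℝ} (ha : ∀ j, a j = 1 ∨ a j = -1) {θ₀ : Fin m → Vec n}
    (hθ₀ : ∀ j, ‖θ₀ j‖ = 1) (hσ : 0 < sigma0 x a θ₀)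
    (hstab : ∀ θ : Fin m → Vec n, (∀ j, ‖θ j‖ = 1) →
      weightDist θ θ₀ ≤ 4 * κL * (μ * sigma0 x a θ₀)⁻¹ * residual x y a θ₀ →
      frobNorm (jacobian x a θ - jacobian x a θ₀) ≤
        4 / 5 * min (1 / 2) (μ / (6 * κL)) * sigma0 x a θ₀)
    (hη : 0 < η) (hη1 : η ≤ 1)
    (hstep : residual x y a θ₀ ≠ 0 → η ≤ (1 / (6 * residual x y a θ₀) - κH / (2 * μ)) *
      (3 * μ ^ 2 * sigma0 x a θ₀ / (8 * (1 * (1 / 4 + frobNorm (jacobian x a θ₀) /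
        (2 * sigma0 x a θ₀))) * κL ^ 2)))
    (k : ℕ) :
    residual x y a (rngd ν p η x y a θ₀ (k + 1)) ≤
      (1 - η / 2) * residual x y a (rngd ν p η x y a θ₀ k) := by
  have hinv : ∀ k, (∀ j, ‖rngd ν p η x y a θ₀ k j‖ = 1) ∧
      weightDist (rngd ν p η x y a θ₀ k) θ₀ +
        4 * κL * (μ * sigma0 x a θ₀)⁻¹ * residual x y a (rngd ν p η x y a θ₀ k) ≤
          4 * κL * (μ * sigma0 x a θ₀)⁻¹ * residual x y a θ₀ := by
    intro k
    induction k with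
    | zero => exact ⟨hθ₀, by rw [rngd, weightDist_self, zero_add]⟩
    | succ k ih =>
      have := rngd_step h hl ha hσ hstab hη hη1 hstep ih.1 ih.2 rfl
      exact ⟨this.1, this.2.2⟩
  exact (rngd_step h hl ha hσ hstab hη hη1 hstep (hinv k).1 (hinv k).2 rfl).2.1

/-! ### The two high-probability events -/

/-- Turns a width condition on a random σ into a comparison with a deterministic `s`, so that the
event can be fixed before σ is known. For `m = 0` the condition is void. -/
theorem exists_width_threshold {K : ℝ} (hK : 0 < K) (m : ℕ) :
    ∃ s : ℝ, 0 < s ∧ ∀ σ : ℝ, 0 < σ → K / σ ^ 8 ≤ m → s ≤ σ ∧ m * s ^ 8 = K := by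
  rcases Nat.eq_zero_or_pos m with rfl | hm
  · refine ⟨1, one_pos, fun σ hσ h => ?_⟩
    have : 0 < K / σ ^ 8 := by positivity
    rw [Nat.cast_zero] at h
    linarith
  · have hm' : (0 : ℝ) < m := by exact_mod_cast hm
    have hs : ((K / m) ^ ((8 : ℕ) : ℝ)⁻¹) ^ 8 = K / m :=
      Real.rpow_inv_natCast_pow (by positivity) (by norm_num)
    refine ⟨(K / m) ^ ((8 : ℕ) : ℝ)⁻¹, by positivity, fun σ hσ h => ⟨?_, ?_⟩⟩
    · refine le_of_pow_le_pow_left₀ (n := 8) (by norm_num) hσ.le ?_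
      rw [hs]
      rw [div_le_iff₀ (by positivity)] at h
      rw [div_le_iff₀ hm']
      linarith
    · rw [hs]
      field_simp

theorem sq_le_of_le_radius {μ κL σ s r q w : ℝ} (hμ : 0 < μ) (hκL : 0 < κL) (hs : 0 < s)
    (hsσ : s ≤ σ) (hr : r ^ 2 ≤ q) (hw0 : 0 ≤ w) (hw : w ≤ 4 * κL * (μ * σ)⁻¹ * r) :
    w ^ 2 ≤ 16 * κL ^ 2 * q / (μ ^ 2 * s ^ 2) := by
  have hσ : 0 < σ := hs.trans_le hsσ
  calc w ^ 2 ≤ (4 * κL * (μ * σ)⁻¹ * r) ^ 2 := by gcongr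
    _ = 16 * κL ^ 2 * r ^ 2 / (μ ^ 2 * σ ^ 2) := by field_simp; ring
    _ ≤ 16 * κL ^ 2 * q / (μ ^ 2 * s ^ 2) := by
      have : 0 ≤ q := (sq_nonneg r).trans hr
      gcongr

section Events
variable {B L μ κL κH ε : ℝ} {ν : Measure ℝ} {p : ℝ → ℝ → ℝ} {x : Fin N → Vec n} {y : Fin N → ℝ}

theorem DataAssumption.gradBound_pos (h : DataAssumption B x y) : 0 < gradBound x := by
  have := inv_pos.2 h.minEig_pos
  linarith [h.inv_minEig_le]

theorem LossAssumption.mu_le_kappaL (hl : LossAssumption μ κL κH ν p m x y) (i : Fin N) : μ ≤ κL :=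
  (hl.hess_lower i 0).trans (hl.hess_upper i 0)

theorem min_half_div_le {μ κL : ℝ} (hκL : 0 < κL) (h : μ ≤ κL) :
    6 * min (1 / 2) (μ / (6 * κL)) ≤ 1 := by
  have : μ / (6 * κL) ≤ 1 / 6 := by
    rw [div_le_div_iff₀ (by positivity) (by norm_num)]
    linarith
  linarith [min_le_right (1 / 2) (μ / (6 * κL))]

theorem exists_event_jacobianStable (h : DataAssumption B x y)
    (hl : LossAssumption μ κL κH ν p m x y)
    (hLip : ∀ (i : Fin N) (u v : Gr1 n),
      ‖preActGrad x i u - preActGrad x i v‖ ≤ L * ‖(u : Vec n) - v‖)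
    (hL : 0 < L) (hε : 0 < ε) :
    ∃ G : Set ((Fin m → Gr1 n) × (Fin m → ℝ)), MeasurableSet G ∧
      initLaw n m Gᶜ ≤ ENNReal.ofReal ε ∧
      ∀ ω ∈ G, 0 < sigma0 x ω.2 (fun j => (ω.1 j : Vec n)) →
        2 * (1 + B ^ 2) * (128 * (L + 2 * gradBound x) ^ 3 * Real.pi * n * N ^ 6 * κL ^ 2 /
          (μ ^ 2 * sigma0 x ω.2 (fun j => (ω.1 j : Vec n)) ^ 8 * minEig (cov x) * ε ^ 3 *
            min (1 / 2) (μ / (6 * κL)) ^ 6)) ≤ m →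
        JacobianStable μ κL x y ω.2 (fun j => (ω.1 j : Vec n)) := by
  have hμ := hl.mu_pos
  have hκL := hl.kappaL_pos
  have hM := h.gradBound_pos
  have hV := h.minEig_pos
  have hN : (0 : ℝ) < N := by have := h.nonempty; positivity
  have hn2 : (2 : ℝ) ≤ n := by exact_mod_cast h.two_le_dim
  have hn : (0 : ℝ) < n := by linarith
  have hπ := Real.pi_pos
  have hV1 : minEig (cov x) ≤ 1 := by nlinarith [h.dim_mul_minEig_le]
  have hc6 := min_half_div_le hκL (hl.mu_le_kappaL ⟨0, h.nonempty⟩)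
  have hc : 0 < min (1 / 2) (μ / (6 * κL)) := lt_min (by norm_num) (by positivity)
  set c := min (1 / 2) (μ / (6 * κL)) with hc_def
  set A := L + 2 * gradBound x with hA_def
  have hA : 0 < A := by positivity
  -- `K` is the required width with the factor `sigma0 ^ 8` removed. The failure probability is
  -- split evenly between Jacobian variation and residual.
  obtain ⟨s, hs, hthr⟩ := exists_width_threshold
    (K := 2 * (1 + B ^ 2) * (128 * A ^ 3 * Real.pi * n * N ^ 6 * κL ^ 2) /
      (μ ^ 2 * minEig (cov x) * ε ^ 3 * c ^ 6)) (by positivity) m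
  obtain ⟨G, hGm, hGP, hG⟩ := h.exists_event_frobNorm_jacobian_sub_le (m := m) hLip hL
    (mul_pos hc hs) (half_pos hε)
  have hres := (measurable_residual (m := m) x y).pow_const 2
  have hR := measure_compl_le_of_lintegral_le (ε := ε / 2) hres (by positivity) (by positivity)
    h.lintegral_residual_sq_le
  refine ⟨_, hGm.inter (measurableSet_le hres measurable_const),
    (measure_compl_inter_le (by positivity) (by positivity) hGP hR).trans_eq (by rw [add_halves]),
    ?_⟩
  rintro ω ⟨hω, hωr⟩ hσ hm
  obtain ⟨ha, hstab⟩ := hG ω hω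
  simp only [Set.mem_ofPred_eq] at hωr
  obtain ⟨hsσ, hms⟩ := hthr _ hσ (by
    refine le_trans (le_of_eq ?_) hm
    field_simp)
  refine ⟨hσ, fun θ hθ hw => (hstab (by nlinarith) θ hθ ?_).trans ?_⟩
  · have h1 := sq_le_of_le_radius hμ hκL hs hsσ hωr (weightDist_nonneg _ _) hw
    calc _ ≤ 16 * κL ^ 2 * (2 * (1 + B ^ 2) * N / (ε / 2)) / (μ ^ 2 * s ^ 2) *
          (A ^ 3 * Real.pi * n * N ^ 5) := by gcongr
      _ = 64 * (1 + B ^ 2) * A ^ 3 * Real.pi * n * N ^ 6 * κL ^ 2 / (μ ^ 2 * ε * s ^ 2) * 1 := by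
          field_simp; ring
      -- The only loss in this computation: the factor `1/σ_V ≥ 1` in the width condition is
      -- inserted. The remaining steps are equalities, which is where `2 * (1 + B ^ 2)` comes from.
      _ ≤ 64 * (1 + B ^ 2) * A ^ 3 * Real.pi * n * N ^ 6 * κL ^ 2 / (μ ^ 2 * ε * s ^ 2) *
          (minEig (cov x))⁻¹ := by
          gcongr
          exact (one_le_inv₀ hV).2 hV1
      _ = (m * s ^ 8) * c ^ 6 * ε ^ 2 / (4 * s ^ 2) := by
          rw [hms]; field_simp; norm_num
      _ = _ := by field_simp; norm_num
  · have : c * s ≤ c * sigma0 x ω.2 (fun j => (ω.1 j : Vec n)) := by gcongr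
    have : 0 < c * s := by positivity
    linarith

theorem exists_event_rngd_residual_le (h : DataAssumption B x y)
    (hl : LossAssumption μ κL κH ν p m x y)
    (hLip : ∀ (i : Fin N) (u v : Gr1 n),
      ‖preActGrad x i u - preActGrad x i v‖ ≤ L * ‖(u : Vec n) - v‖)
    (hL : 0 < L) (hε : 0 < ε) :
    ∃ G : Set ((Fin m → Gr1 n) × (Fin m → ℝ)), MeasurableSet G ∧
      initLaw n m Gᶜ ≤ ENNReal.ofReal ε ∧
      ∀ ω ∈ G,
        let θ₀ : Fin m → Vec n := fun j => ω.1 j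
        let a := ω.2
        let σ₀ := sigma0 x a θ₀
        let r₀ := residual x y a θ₀
        0 < σ₀ →
        16 * (L + 2 * gradBound x) ^ 3 * Real.pi * n * N ^ 5 * κL ^ 2 /
          (9 * σ₀ ^ 8 * κH ^ 2 * ε ^ 2 * min (1 / 2) (μ / (6 * κL)) ^ 6) ≤ m →
        r₀ ≤ μ / (3 * κH) →
        ∀ η : ℝ, 0 < η → η ≤ 1 →
          (r₀ ≠ 0 → η ≤ (1 / (6 * r₀) - κH / (2 * μ)) * (3 * μ ^ 2 * σ₀ /
            (8 * (1 * (1 / 4 + frobNorm (jacobian x a θ₀) / (2 * σ₀))) * κL ^ 2))) →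
          ∀ k : ℕ, residual x y a (rngd ν p η x y a θ₀ (k + 1)) ≤
            (1 - η / 2) * residual x y a (rngd ν p η x y a θ₀ k) := by
  have hμ := hl.mu_pos
  have hκL := hl.kappaL_pos
  have hκH := hl.kappaH_pos
  have hM := h.gradBound_pos
  have hN : (0 : ℝ) < N := by have := h.nonempty; positivity
  have hn2 : (2 : ℝ) ≤ n := by exact_mod_cast h.two_le_dim
  have hn : (0 : ℝ) < n := by linarith
  have hπ := Real.pi_pos
  have hc6 := min_half_div_le hκL (hl.mu_le_kappaL ⟨0, h.nonempty⟩)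
  have hc : 0 < min (1 / 2) (μ / (6 * κL)) := lt_min (by norm_num) (by positivity)
  set c := min (1 / 2) (μ / (6 * κL)) with hc_def
  set A := L + 2 * gradBound x with hA_def
  have hA : 0 < A := by positivity
  obtain ⟨s, hs, hthr⟩ := exists_width_threshold
    (K := 16 * A ^ 3 * Real.pi * n * N ^ 5 * κL ^ 2 / (9 * κH ^ 2 * ε ^ 2 * c ^ 6))
    (by positivity) m
  obtain ⟨G, hGm, hGP, hG⟩ := h.exists_event_frobNorm_jacobian_sub_le (m := m) hLip hL
    (mul_pos hc hs) hε
  refine ⟨G, hGm, hGP, ?_⟩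
  intro ω hω θ₀ a σ₀ r₀ hσ hm hr₀ η hη hη1 hstep k
  obtain ⟨ha, hstab⟩ := hG ω hω
  obtain ⟨hsσ, hms⟩ := hthr _ hσ (by
    refine le_trans (le_of_eq ?_) hm
    field_simp)
  refine rngd_residual_le h hl ha (fun j => mem_sphere_zero_iff_norm.1 (ω.1 j).2) hσ (fun θ hθ hw => ?_) hη hη1 hstep k
  refine (hstab (by nlinarith) θ hθ ?_).trans ?_
  -- The assumed residual bound replaces the Markov estimate, so the full ε goes to the Jacobian
  -- event and neither `B` nor `σ_V` enters the width.
  · have hq : r₀ ^ 2 ≤ (μ / (3 * κH)) ^ 2 := by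
      have : 0 ≤ r₀ := vecNorm_nonneg _
      gcongr
    have h1 := sq_le_of_le_radius hμ hκL hs hsσ hq (weightDist_nonneg _ _) hw
    calc _ ≤ 16 * κL ^ 2 * (μ / (3 * κH)) ^ 2 / (μ ^ 2 * s ^ 2) *
          (A ^ 3 * Real.pi * n * N ^ 5) := by gcongr
      _ = (m * s ^ 8) * c ^ 6 * ε ^ 2 / s ^ 2 := by rw [hms]; field_simp; norm_num
      _ = _ := by field_simp
  · have : c * s ≤ c * σ₀ := by gcongr
    rw [mul_assoc]
    linarith

end Events

end RNGD

theorem theorem5p3 :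
    ∃ κ₁ : ℝ, 0 < κ₁ ∧ ∀ B : ℝ, ∃ C : ℝ, 0 < C ∧
    ∀ (n N m : ℕ) (x : Fin N → RNGD.Vec n) (y : Fin N → ℝ)
      (ν : MeasureTheory.Measure ℝ) (p : ℝ → ℝ → ℝ) (μ κL κH L ε : ℝ),
      RNGD.DataAssumption B x y →
      RNGD.LossAssumption μ κL κH ν p m x y →
      (∀ (i : Fin N) (u v : RNGD.Gr1 n),
        ‖RNGD.preActGrad x i u - RNGD.preActGrad x i v‖ ≤ L * ‖(u : RNGD.Vec n) - v‖) →
      0 < L → 0 < ε →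
      -- Jacobian stability
      (∃ G : Set ((Fin m → RNGD.Gr1 n) × (Fin m → ℝ)), MeasurableSet G ∧
        ENNReal.ofReal (1 - ε) ≤ RNGD.initLaw n m G ∧
        ∀ ω ∈ G,
          let θ₀ : Fin m → RNGD.Vec n := fun j => ω.1 j
          let a := ω.2
          let σ₀ := RNGD.sigma0 x a θ₀
          0 < σ₀ →
          C * (128 * (L + 2 * RNGD.gradBound x) ^ 3 * Real.pi * n * N ^ 6 * κL ^ 2 /
            (μ ^ 2 * σ₀ ^ 8 * RNGD.minEig (RNGD.cov x) * ε ^ 3 *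
              min (1 / 2) (μ / (6 * κL)) ^ 6)) ≤ m →
          RNGD.JacobianStable μ κL x y a θ₀) ∧
      -- linear convergence
      (∃ G : Set ((Fin m → RNGD.Gr1 n) × (Fin m → ℝ)), MeasurableSet G ∧
        ENNReal.ofReal (1 - ε) ≤ RNGD.initLaw n m G ∧
        ∀ ω ∈ G,
          let θ₀ : Fin m → RNGD.Vec n := fun j => ω.1 j
          let a := ω.2
          let σ₀ := RNGD.sigma0 x a θ₀
          let r₀ := RNGD.residual x y a θ₀
          let κR := κ₁ * (1 / 4 + RNGD.frobNorm (RNGD.jacobian x a θ₀) / (2 * σ₀))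
          0 < σ₀ →
          16 * (L + 2 * RNGD.gradBound x) ^ 3 * Real.pi * n * N ^ 5 * κL ^ 2 /
            (9 * σ₀ ^ 8 * κH ^ 2 * ε ^ 2 * min (1 / 2) (μ / (6 * κL)) ^ 6) ≤ m →
          r₀ ≤ μ / (3 * κH) →
          ∀ η : ℝ, 0 < η → η ≤ 1 →
            (r₀ ≠ 0 → η ≤ (1 / (6 * r₀) - κH / (2 * μ)) *
              (3 * μ ^ 2 * σ₀ / (8 * κR * κL ^ 2))) →
            ∀ k : ℕ,
              RNGD.residual x y a (RNGD.rngd ν p η x y a θ₀ (k + 1)) ≤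
                (1 - η / 2) * RNGD.residual x y a (RNGD.rngd ν p η x y a θ₀ k)) := by
  -- `κ₁ = 1` suffices because great circles have unit curvature: the velocity turns by at most the
  -- squared step length. `C` is the constant in the second-moment bound of the initial residual.
  refine ⟨1, one_pos, fun B => ⟨2 * (1 + B ^ 2), by positivity, ?_⟩⟩
  intro n N m x y ν p μ κL κH L ε h hl hLip hL hε
  have := h.isProbabilityMeasure
  have : MeasureTheory.IsProbabilityMeasure (RNGD.initLaw n m) := by
    unfold RNGD.initLaw; infer_instance
  obtain ⟨G₁, hm₁, hP₁, hG₁⟩ := RNGD.exists_event_jacobianStable h hl hLip hL hε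
  obtain ⟨G₂, hm₂, hP₂, hG₂⟩ := RNGD.exists_event_rngd_residual_le h hl hLip hL hε
  exact ⟨⟨G₁, hm₁, RNGD.ofReal_one_sub_le_measure hε.le hm₁ hP₁, hG₁⟩,
    ⟨G₂, hm₂, RNGD.ofReal_one_sub_le_measure hε.le hm₂ hP₂, hG₂⟩⟩
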